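/- Let $n\ge 0$ and $m\ge 1$ be integers and $\alpha\ge 0$. Let $\boldsymbol X=(X_1,\dots,X_n)$ be a random vector with independent components, $X_i$ taking values in a measurable space $S_i$, and let $f$ be a bounded measurable real-valued function on $\boldsymbol S=S_1\times\cdots\times S_n$. For $\boldsymbol y\in\boldsymbol S$ and $j\in[n]=\{1,\dots,n\}$ let $R^j_{\boldsymbol y}[f](\boldsymbol x)=f(x_1,\dots,x_{j-1},y_j,x_{j+1},\dots,x_n)$ and $\partial^j_{\boldsymbol y}=I-R^j_{\boldsymbol y}$; for $V=\{v_1,\dots,v_k\}\subseteq[n]$ let $\partial^V_{\boldsymbol y}=\partial^{v_1}_{\boldsymbol y}\cdots\partial^{v_k}_{\boldsymbol y}$ and $$\Delta_V(f)=\sup_{\boldsymbol x,\boldsymbol y\in\boldsymbol S}\bigl|\partial^V_{\boldsymbol y}[f](\boldsymbol x)\bigr| .$$ For a bounded random variable $Z$ and $r\ge 1$, let $$\kappa_r(Z)=\sum_{\tau}(-1)^{|\tau|-1}(|\tau|-1)!\prod_{B\in\tau}\mathbf E\,Z^{|B|}$$ be its cumulant of order $r$, where $\tau$ runs over all partitions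 of $[r]$ into non-empty blocks. Suppose that $$\sum_{V\subseteq[n],\ |V|=v,\ j\in V}\Delta_V(f)\le\alpha\qquad\text{for all } v\in\{1,\dots,m\}\text{ and } j\in[n].$$ Then there is a real number $\delta>-1$ with $|\delta|\le e^{(100\alpha)^{m+1}}-1$ such that $$\mathbf E\,e^{f(\boldsymbol X)}=(1+\delta)^n\exp\Bigl(\sum_{r=1}^m\frac{\kappa_r(f(\boldsymbol X))}{r!}\Bigr).$$ Furthermore, for every integer $r$ with $2\le r\le m$, $$|\kappa_r(f(\boldsymbol X))|\le 0.014\,n\,\frac{(r-1)!}{r}\,(80\alpha)^r .$$ -/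

import Mathlib

open MeasureTheory ProbabilityTheory
open scoped Nat

noncomputable section

namespace CumulantExpansion

/-- The linear operator `R^j_y` on real functions on a product `∏ i, S i`:
it replaces the `j`-th coordinate of the argument by `y j`. -/
def replaceOp {n : ℕ} {S : Fin n → Type*} (y : ∀ i, S i) (j : Fin n) :
    Module.End ℝ ((∀ i, S i) → ℝ) where
  toFun f := fun x => f (Function.update x j (y j))
  map_add' _ _ := rfl
  map_smul' _ _ := rfl

/-- The difference operator `∂^j_y = I - R^j_y`. -/
def diffOp {n : ℕ} {S : Fin n → Type*} (y : ∀ i, S i) (j : Fin n) :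
    Module.End ℝ ((∀ i, S i) → ℝ) :=
  1 - replaceOp y j

theorem replaceOp_commute {n : ℕ} {S : Fin n → Type*} (y : ∀ i, S i) (j k : Fin n) :
    Commute (replaceOp y j) (replaceOp y k) := by
  rcases eq_or_ne j k with rfl | h
  · exact Commute.refl _
  · refine LinearMap.ext fun f => funext fun x => ?_
    exact congrArg f (Function.update_comm h.symm _ _ _).symm

theorem diffOp_commute {n : ℕ} {S : Fin n → Type*} (y : ∀ i, S i) (j k : Fin n) :
    Commute (diffOp y j) (diffOp y k) :=
  ((Commute.one_left _).sub_left
    ((Commute.one_right _).sub_right (replaceOp_commute y j k)))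

theorem diffOp_pairwise {n : ℕ} {S : Fin n → Type*} (y : ∀ i, S i) (V : Finset (Fin n)) :
    (V : Set (Fin n)).Pairwise (Function.onFun Commute (diffOp y)) :=
  fun j _ k _ _ => diffOp_commute y j k

/-- The iterated mixed difference `∂^V_y = ∂^{v₁}_y ⋯ ∂^{v_k}_y` for `V = {v₁, …, v_k}`;
the factors commute, so their order does not matter. -/
def mixedDiff {n : ℕ} {S : Fin n → Type*} (y : ∀ i, S i) (V : Finset (Fin n)) :
    Module.End ℝ ((∀ i, S i) → ℝ) :=
  V.noncommProd (diffOp y) (diffOp_pairwise y V)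

/-- `Δ_V(f) = sup_{x, y} |∂^V_y f (x)|`. The supremum is a real one; it is finite whenever
`f` is bounded. -/
def mixedDelta {n : ℕ} {S : Fin n → Type*} (V : Finset (Fin n)) (f : (∀ i, S i) → ℝ) : ℝ :=
  ⨆ p : (∀ i, S i) × (∀ i, S i), |mixedDiff p.2 V f p.1|

/-- The joint cumulant of `Z₁, …, Z_r`:
`∑_τ (-1)^(|τ|-1) (|τ|-1)! ∏_{B ∈ τ} E[∏_{i ∈ B} Z_i]`, the sum being over all partitions `τ` of
the index set into non-empty blocks. -/
def jointCumulant {Ω : Type*} [MeasurableSpace Ω] (μ : Measure Ω) {r : ℕ}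
    (Z : Fin r → Ω → ℝ) : ℝ :=
  ∑ τ : Finpartition (Finset.univ : Finset (Fin r)),
    (-1 : ℝ) ^ (τ.parts.card - 1) * ((τ.parts.card - 1)! : ℝ) *
      ∏ B ∈ τ.parts, ∫ ω, ∏ i ∈ B, Z i ω ∂μ

/-- The cumulant `κ_r(Z) = κ(Z, …, Z)` (with `r` arguments) of order `r ≥ 1`. -/
def cumulant {Ω : Type*} [MeasurableSpace Ω] (μ : Measure Ω) (r : ℕ) (Z : Ω → ℝ) : ℝ :=
  jointCumulant μ (fun _ : Fin r => Z)

end CumulantExpansion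

end

/-!
# The cumulant expansion for functions of independent random variables

Averaging over one coordinate `c` at a time replaces the formal power series `log E[exp (X f)]`
by a composition of elementary steps `g ↦ log E_c[exp g]`, starting from `g = X f`. After all
coordinates have been averaged, the coefficients are the cumulants of `f` divided by factorials
(`coeff_eliminateAll_finRange`), because the partition sum defining a cumulant is a coefficient of
the formal logarithm of the moment generating function (`coeff_log_momentSeries`).

Writing `h = g - E_c g`, a step is `g ↦ E_c g + log (1 + E_c[exp h - 1 - h])` (`eliminate`). It is
controlled by the sums `∑ τ^r 4^{1-|V|} Δ_V(g_r)` over all orders `r` and all sets `V` containing a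
given coordinate `j` (`anchoredWeight`), which are at most `1/10` for `g = X f` and `τ = 3/(40 α)`.
Mixed differences obey a Leibniz rule (`diffSup_mul_le`), so that weighted sums of them behave like
submultiplicative norms and derivations, to which the power series of `exp` and `log` can be
applied. A difference `∂^V` of `h` is an average of the differences `∂^{V ∪ {c}}` of `g`. The new
terms at `V ∌ c` created by a step are therefore bounded by the terms of `g` at `V ∪ {c}`, and the
latter disappear since the result no longer depends on the coordinate `c`. Hence the anchored sums
never increase (`weightedSum_eliminate_le`), uniformly in the number of steps. Only the sets of at
most `m` coordinates are under control, so all sums are restricted to `r + |V| ≤ m + 1`, a condition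
that is preserved as every factor of a product has positive order in `X`.

Consequently each of the `n` steps changes the coefficient of order `r ≥ 2` by at most `τ^{-r}/80`
(`abs_coeff_eliminateAll_le`), which bounds the cumulants. It also changes
`log E_c[exp g]`, evaluated at `X = 1` and truncated at order `m`, by a tail of a series which is at
most `τ^{-(m+1)}/80` as long as `τ ≥ 1` (`exists_avg_expFun_partialSum`). These errors add up to the
logarithm of `(1 + δ)^n`. If `τ < 1`, the crude bound `|f - E f| ≤ n α` suffices.
-/

noncomputable section

namespace CumulantExpansion

open scoped ENNReal

/-! ### Mixed differences and their suprema -/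

section Differences

variable {n : ℕ} {S : Fin n → Type*}

theorem replaceOp_apply (y : ∀ i, S i) (j : Fin n) (F : (∀ i, S i) → ℝ) (x : ∀ i, S i) :
    replaceOp y j F x = F (Function.update x j (y j)) := rfl

theorem diffOp_apply (y : ∀ i, S i) (j : Fin n) (F : (∀ i, S i) → ℝ) (x : ∀ i, S i) :
    diffOp y j F x = F x - F (Function.update x j (y j)) := rfl

theorem mixedDiff_empty (y : ∀ i, S i) : mixedDiff y ∅ = 1 :=
  Finset.noncommProd_empty _ _

theorem mixedDiff_insert (y : ∀ i, S i) {j : Fin n} {V : Finset (Fin n)} (hj : j ∉ V) :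
    mixedDiff y (insert j V) = diffOp y j * mixedDiff y V :=
  Finset.noncommProd_insert_of_notMem _ _ _ _ hj

theorem mixedDiff_insert' (y : ∀ i, S i) {j : Fin n} {V : Finset (Fin n)} (hj : j ∉ V) :
    mixedDiff y (insert j V) = mixedDiff y V * diffOp y j :=
  Finset.noncommProd_insert_of_notMem' _ _ _ _ hj

theorem mixedDiff_singleton (y : ∀ i, S i) (j : Fin n) : mixedDiff y {j} = diffOp y j :=
  Finset.noncommProd_singleton _ _

/-- The operator `∂^V_y` depends only on the coordinates of `y` in `V`. -/
theorem mixedDiff_congr {y z : ∀ i, S i} {V : Finset (Fin n)} (h : ∀ i ∈ V, y i = z i) :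
    mixedDiff y V = mixedDiff z V := by
  refine Finset.noncommProd_congr rfl (fun i hi => ?_) _
  refine LinearMap.ext fun F => funext fun x => ?_
  simp only [diffOp_apply, h i hi]

/-- Replacing a coordinate outside `V`, by an arbitrary value, commutes with `∂^V`. -/
theorem replaceOp_commute_mixedDiff (y z : ∀ i, S i) {c : Fin n} {V : Finset (Fin n)}
    (hc : c ∉ V) : Commute (replaceOp z c) (mixedDiff y V) := by
  refine Finset.noncommProd_commute _ _ _ _ fun j hj => ?_
  refine (Commute.one_right _).sub_right ?_
  have hne : c ≠ j := fun h => hc (h ▸ hj)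
  refine LinearMap.ext fun F => funext fun x => ?_
  exact congrArg F (Function.update_comm hne _ _ _)

theorem replaceOp_self_commute_mixedDiff (y : ∀ i, S i) (c : Fin n) (V : Finset (Fin n)) :
    Commute (replaceOp y c) (mixedDiff y V) := by
  refine Finset.noncommProd_commute _ _ _ _ fun j _ => ?_
  exact (Commute.one_right _).sub_right (replaceOp_commute y c j)

/-- A mixed difference in a coordinate on which the function does not depend vanishes. -/
theorem mixedDiff_eq_zero_of_mem {y : ∀ i, S i} {c : Fin n} {V : Finset (Fin n)} (hc : c ∈ V)
    {F : (∀ i, S i) → ℝ} (hF : ∀ x u, F (Function.update x c u) = F x) :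
    mixedDiff y V F = 0 := by
  rw [← Finset.insert_erase hc, mixedDiff_insert' y (Finset.notMem_erase c V)]
  have : diffOp y c F = 0 := funext fun x => by simp [diffOp_apply, hF]
  simp [Module.End.mul_apply, this]

theorem abs_mixedDiff_le {F : (∀ i, S i) → ℝ} {C : ℝ} (hF : ∀ x, |F x| ≤ C) (y : ∀ i, S i)
    (V : Finset (Fin n)) (x : ∀ i, S i) : |mixedDiff y V F x| ≤ 2 ^ V.card * C := by
  induction V using Finset.induction_on generalizing x with
  | empty => simpa [mixedDiff_empty] using hF x
  | insert j V hj ih =>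
    rw [mixedDiff_insert y hj, Module.End.mul_apply, diffOp_apply, Finset.card_insert_of_notMem hj]
    refine (abs_sub _ _).trans ?_
    rw [pow_succ]
    linarith [ih x, ih (Function.update x j (y j))]

/-- The supremum of `|∂^V_y F (x)|` over all `x` and `y`, as an extended nonnegative real: the
`ℝ≥0∞`-valued version of `mixedDelta`, which needs no boundedness assumption. -/
def diffSup (V : Finset (Fin n)) (F : (∀ i, S i) → ℝ) : ℝ≥0∞ :=
  ⨆ y : ∀ i, S i, ⨆ x : ∀ i, S i, ‖mixedDiff y V F x‖ₑ

theorem enorm_mixedDiff_le_diffSup (y : ∀ i, S i) (V : Finset (Fin n)) (F : (∀ i, S i) → ℝ)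
    (x : ∀ i, S i) : ‖mixedDiff y V F x‖ₑ ≤ diffSup V F :=
  (le_iSup (fun x => ‖mixedDiff y V F x‖ₑ) x).trans
    (le_iSup (fun y => ⨆ x, ‖mixedDiff y V F x‖ₑ) y)

theorem enorm_le_diffSup_empty (F : (∀ i, S i) → ℝ) (x : ∀ i, S i) :
    ‖F x‖ₑ ≤ diffSup ∅ F := by
  simpa [mixedDiff_empty] using enorm_mixedDiff_le_diffSup x ∅ F x

theorem diffSup_le_iff {V : Finset (Fin n)} {F : (∀ i, S i) → ℝ} {a : ℝ≥0∞} :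
    diffSup V F ≤ a ↔ ∀ y x, ‖mixedDiff y V F x‖ₑ ≤ a := by
  simp [diffSup, iSup_le_iff]

theorem diffSup_zero (V : Finset (Fin n)) : diffSup V (0 : (∀ i, S i) → ℝ) = 0 := by
  rw [← nonpos_iff_eq_zero, diffSup_le_iff]
  simp

theorem diffSup_add_le (V : Finset (Fin n)) (F G : (∀ i, S i) → ℝ) :
    diffSup V (F + G) ≤ diffSup V F + diffSup V G := by
  rw [diffSup_le_iff]
  intro y x
  rw [map_add, Pi.add_apply]
  exact (enorm_add_le _ _).trans
    (add_le_add (enorm_mixedDiff_le_diffSup y V F x) (enorm_mixedDiff_le_diffSup y V G x))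

theorem diffSup_smul_le (V : Finset (Fin n)) (a : ℝ) (F : (∀ i, S i) → ℝ) :
    diffSup V (a • F) ≤ ‖a‖ₑ * diffSup V F := by
  rw [diffSup_le_iff]
  intro y x
  rw [map_smul, Pi.smul_apply, smul_eq_mul, enorm_mul]
  exact mul_le_mul_right (enorm_mixedDiff_le_diffSup y V F x) _

theorem diffSup_sum_le {ι : Type*} (s : Finset ι) (V : Finset (Fin n))
    (F : ι → (∀ i, S i) → ℝ) : diffSup V (∑ i ∈ s, F i) ≤ ∑ i ∈ s, diffSup V (F i) :=
  Finset.le_sum_of_subadditive _ (diffSup_zero V).le (diffSup_add_le V) s F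

theorem diffSup_eq_zero_of_mem {c : Fin n} {V : Finset (Fin n)} (hc : c ∈ V)
    {F : (∀ i, S i) → ℝ} (hF : ∀ x u, F (Function.update x c u) = F x) : diffSup V F = 0 := by
  rw [← nonpos_iff_eq_zero, diffSup_le_iff]
  intro y x
  simp [mixedDiff_eq_zero_of_mem hc hF]

theorem diffSup_le_mixedDelta (V : Finset (Fin n)) {F : (∀ i, S i) → ℝ}
    (hF : ∃ C : ℝ, ∀ x, |F x| ≤ C) : diffSup V F ≤ ENNReal.ofReal (mixedDelta V F) := by
  obtain ⟨C, hC⟩ := hF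
  rw [diffSup_le_iff]
  intro y x
  rw [Real.enorm_eq_ofReal_abs]
  refine ENNReal.ofReal_le_ofReal ?_
  refine le_ciSup (f := fun p : (∀ i, S i) × (∀ i, S i) => |mixedDiff p.2 V F p.1|) ?_ (x, y)
  exact ⟨2 ^ V.card * C, by rintro _ ⟨p, rfl⟩; exact abs_mixedDiff_le hC p.2 V p.1⟩

/-- The Leibniz rule `∂^j (F G) = ∂^j F · G + R^j F · ∂^j G`, iterated and bounded: the mixed
differences of a product are controlled by a sum over all ways of splitting `V` in two. -/
theorem diffSup_mul_le (V : Finset (Fin n)) (F G : (∀ i, S i) → ℝ) :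
    diffSup V (F * G) ≤ ∑ U ∈ V.powerset, diffSup U F * diffSup (V \ U) G := by
  have key : ∀ (y : ∀ i, S i) (V : Finset (Fin n)) (F G : (∀ i, S i) → ℝ) (x : ∀ i, S i),
      ‖mixedDiff y V (F * G) x‖ₑ ≤ ∑ U ∈ V.powerset,
        (⨆ x, ‖mixedDiff y U F x‖ₑ) * ⨆ x, ‖mixedDiff y (V \ U) G x‖ₑ := by
    intro y V
    induction V using Finset.induction_on with
    | empty =>
      intro F G x
      simp only [mixedDiff_empty, Finset.powerset_empty, Finset.sum_singleton,
        Module.End.one_apply, Pi.mul_apply, enorm_mul, Finset.sdiff_empty]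
      exact mul_le_mul' (le_iSup (fun x => ‖F x‖ₑ) x) (le_iSup (fun x => ‖G x‖ₑ) x)
    | insert j V hj ih =>
      intro F G x
      have hL : diffOp y j (F * G) = diffOp y j F * G + replaceOp y j F * diffOp y j G := by
        funext x
        simp only [diffOp_apply, replaceOp_apply, Pi.mul_apply, Pi.add_apply]
        ring
      rw [mixedDiff_insert' y hj, Module.End.mul_apply, hL, map_add, Pi.add_apply,
        Finset.sum_powerset_insert hj, add_comm]
      refine (enorm_add_le _ _).trans (add_le_add ((ih _ _ x).trans ?_) ((ih _ _ x).trans ?_))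
      · refine Finset.sum_le_sum fun U hU => ?_
        have hjU : j ∉ U := fun h => hj (Finset.mem_powerset.1 hU h)
        refine mul_le_mul' (iSup_le fun x => ?_) ?_
        · have := congrFun (LinearMap.congr_fun (replaceOp_self_commute_mixedDiff y j U).eq F) x
          rw [Module.End.mul_apply, Module.End.mul_apply] at this
          rw [← this, replaceOp_apply]
          exact le_iSup (fun x => ‖mixedDiff y U F x‖ₑ) _
        · rw [Finset.insert_sdiff_of_notMem _ hjU,
            mixedDiff_insert' y (fun h => hj (Finset.sdiff_subset h))]
          rfl
      · refine Finset.sum_le_sum fun U hU => ?_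
        have hjU : j ∉ U := fun h => hj (Finset.mem_powerset.1 hU h)
        refine mul_le_mul' ?_ ?_
        · rw [mixedDiff_insert' y hjU]
          rfl
        · have : insert j V \ insert j U = V \ U := by
            ext i
            simp only [Finset.mem_sdiff, Finset.mem_insert]
            grind
          rw [this]
  rw [diffSup_le_iff]
  intro y x
  refine (key y V F G x).trans (Finset.sum_le_sum fun U _ => mul_le_mul' ?_ ?_)
  · exact le_iSup (fun y => ⨆ x, ‖mixedDiff y U F x‖ₑ) y
  · exact le_iSup (fun y => ⨆ x, ‖mixedDiff y (V \ U) G x‖ₑ) y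

variable {U : Type*} [MeasurableSpace U] {ν : Measure U}

/-- Mixed differences commute with integration over a parameter. -/
theorem mixedDiff_integral {K : U → (∀ i, S i) → ℝ} (hK : ∀ x, Integrable (fun u => K u x) ν)
    (y : ∀ i, S i) (V : Finset (Fin n)) (x : ∀ i, S i) :
    Integrable (fun u => mixedDiff y V (K u) x) ν ∧
      mixedDiff y V (fun x => ∫ u, K u x ∂ν) x = ∫ u, mixedDiff y V (K u) x ∂ν := by
  induction V using Finset.induction_on generalizing x with
  | empty => exact ⟨by simpa [mixedDiff_empty] using hK x, by simp [mixedDiff_empty]⟩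
  | insert j V hj ih =>
    simp only [mixedDiff_insert y hj, Module.End.mul_apply, diffOp_apply]
    refine ⟨(ih x).1.sub (ih _).1, ?_⟩
    rw [(ih x).2, (ih _).2, integral_sub (ih x).1 (ih _).1]

theorem diffSup_integral_le [IsProbabilityMeasure ν] {K : U → (∀ i, S i) → ℝ}
    (hK : ∀ x, Integrable (fun u => K u x) ν) (V : Finset (Fin n)) {a : ℝ≥0∞}
    (ha : ∀ y x u, ‖mixedDiff y V (K u) x‖ₑ ≤ a) :
    diffSup V (fun x => ∫ u, K u x ∂ν) ≤ a := by
  rw [diffSup_le_iff]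
  intro y x
  rw [(mixedDiff_integral hK y V x).2]
  refine (enorm_integral_le_lintegral_enorm _).trans ?_
  refine (lintegral_mono fun u => ha y x u).trans ?_
  simp

end Differences

/-! ### Averaging over one coordinate -/

/-- The algebra of bounded measurable real functions on the product `∏ i, S i`. -/
def boundedMeasurable {n : ℕ} (S : Fin n → Type*) [∀ i, MeasurableSpace (S i)] :
    Subalgebra ℝ ((∀ i, S i) → ℝ) where
  carrier := {F | Measurable F ∧ ∃ C : ℝ, ∀ x, |F x| ≤ C}
  mul_mem' := by
    rintro F G ⟨hF, C, hC⟩ ⟨hG, D, hD⟩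
    refine ⟨hF.mul hG, C * D, fun x => ?_⟩
    rw [Pi.mul_apply, abs_mul]
    exact mul_le_mul (hC x) (hD x) (abs_nonneg _) ((abs_nonneg _).trans (hC x))
  add_mem' := by
    rintro F G ⟨hF, C, hC⟩ ⟨hG, D, hD⟩
    exact ⟨hF.add hG, C + D, fun x => (abs_add_le _ _).trans (add_le_add (hC x) (hD x))⟩
  algebraMap_mem' a := ⟨measurable_const, |a|, fun _ => le_rfl⟩

section Averaging

variable {n : ℕ} {S : Fin n → Type*} [∀ i, MeasurableSpace (S i)]

theorem integrable_update (ν : ∀ i, Measure (S i)) [∀ i, IsProbabilityMeasure (ν i)]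
    (c : Fin n) (F : boundedMeasurable S) (x : ∀ i, S i) :
    Integrable (fun u => F.1 (Function.update x c u)) (ν c) := by
  obtain ⟨hF, C, hC⟩ := F.2
  exact Integrable.of_bound (hF.comp (measurable_update x)).aestronglyMeasurable C
    (Filter.Eventually.of_forall fun u => hC _)

/-- The conditional expectation operator which averages over the `c`-th coordinate. -/
def avg (ν : ∀ i, Measure (S i)) [∀ i, IsProbabilityMeasure (ν i)] (c : Fin n) :
    boundedMeasurable S →ₗ[ℝ] boundedMeasurable S where
  toFun F := ⟨fun x => ∫ u, F.1 (Function.update x c u) ∂ν c, by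
    obtain ⟨hF, C, hC⟩ := F.2
    refine ⟨?_, C, fun x => ?_⟩
    · exact (StronglyMeasurable.integral_prod_right
        (f := fun x u => F.1 (Function.update x c u))
        (hF.comp measurable_update').stronglyMeasurable).measurable
    · have := norm_integral_le_of_norm_le_const (μ := ν c)
        (f := fun u => F.1 (Function.update x c u)) (C := C)
        (Filter.Eventually.of_forall fun u => hC _)
      simpa using this⟩
  map_add' F G := Subtype.ext <| funext fun x =>
    integral_add (integrable_update ν c F x) (integrable_update ν c G x)
  map_smul' a F := Subtype.ext <| funext fun x => integral_const_mul a _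

variable (ν : ∀ i, Measure (S i)) [∀ i, IsProbabilityMeasure (ν i)] (c : Fin n)

theorem avg_apply (F : boundedMeasurable S) (x : ∀ i, S i) :
    (avg ν c F).1 x = ∫ u, F.1 (Function.update x c u) ∂ν c := rfl

theorem avg_update (F : boundedMeasurable S) (x : ∀ i, S i) (u : S c) :
    (avg ν c F).1 (Function.update x c u) = (avg ν c F).1 x := by
  simp [avg_apply]

/-- Averaging over `c` is linear over functions that do not depend on the coordinate `c`. -/
theorem avg_mul_of_update {F : boundedMeasurable S} (G : boundedMeasurable S)
    (hF : ∀ x u, F.1 (Function.update x c u) = F.1 x) : avg ν c (F * G) = F * avg ν c G := by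
  refine Subtype.ext <| funext fun x => ?_
  change ∫ u, F.1 (Function.update x c u) * G.1 (Function.update x c u) ∂ν c
    = F.1 x * ∫ u, G.1 (Function.update x c u) ∂ν c
  simp only [hF]
  exact integral_const_mul _ _

theorem avg_one : avg ν c 1 = 1 := by
  refine Subtype.ext <| funext fun x => ?_
  change ∫ u, (1 : ℝ) ∂ν c = 1
  simp

theorem avg_of_update {F : boundedMeasurable S}
    (hF : ∀ x u, F.1 (Function.update x c u) = F.1 x) : avg ν c F = F := by
  simpa [avg_one] using avg_mul_of_update ν c 1 hF

theorem avg_avg (F : boundedMeasurable S) : avg ν c (avg ν c F) = avg ν c F :=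
  avg_of_update ν c (avg_update ν c F)

theorem avg_mono {F G : boundedMeasurable S} (h : ∀ x, F.1 x ≤ G.1 x) (x : ∀ i, S i) :
    (avg ν c F).1 x ≤ (avg ν c G).1 x :=
  integral_mono (integrable_update ν c F x) (integrable_update ν c G x) fun _ => h _

theorem diffSup_avg_le {V : Finset (Fin n)} (hc : c ∉ V) (F : boundedMeasurable S) :
    diffSup V (avg ν c F).1 ≤ diffSup V F.1 := by
  refine diffSup_integral_le (K := fun u x => F.1 (Function.update x c u))
    (integrable_update ν c F) V fun y x u => ?_
  have h := LinearMap.congr_fun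
    (replaceOp_commute_mixedDiff y (Function.update y c u) hc).eq F.1
  have h' : (fun x => F.1 (Function.update x c u)) = replaceOp (Function.update y c u) c F.1 := by
    funext x
    simp [replaceOp_apply]
  rw [Module.End.mul_apply, Module.End.mul_apply] at h
  rw [h', ← h]
  exact enorm_mixedDiff_le_diffSup _ _ _ _

theorem diffSup_avg_eq_zero {V : Finset (Fin n)} (hc : c ∈ V) (F : boundedMeasurable S) :
    diffSup V (avg ν c F).1 = 0 :=
  diffSup_eq_zero_of_mem hc (avg_update ν c F)

/-- Centring in the coordinate `c` costs one difference in that coordinate. -/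
theorem diffSup_sub_avg_le {V : Finset (Fin n)} (hc : c ∉ V) (F : boundedMeasurable S) :
    diffSup V (F - avg ν c F).1 ≤ diffSup (insert c V) F.1 := by
  have hK : (F - avg ν c F).1 =
      fun x => ∫ u, (F.1 x - F.1 (Function.update x c u)) ∂ν c := by
    funext x
    rw [integral_sub (integrable_const _) (integrable_update ν c F x)]
    simp [avg_apply]
  rw [hK]
  refine diffSup_integral_le (K := fun u x => F.1 x - F.1 (Function.update x c u))
    (fun x => (integrable_const _).sub (integrable_update ν c F x)) V fun y x u => ?_
  have h' : (fun x => F.1 x - F.1 (Function.update x c u)) =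
      diffOp (Function.update y c u) c F.1 := by
    funext x
    simp [diffOp_apply]
  have hy : mixedDiff y V = mixedDiff (Function.update y c u) V :=
    mixedDiff_congr fun i hi => by
      rw [Function.update_of_ne (ne_of_mem_of_not_mem hi hc)]
  rw [h', hy, ← Module.End.mul_apply, ← mixedDiff_insert' _ hc]
  exact enorm_mixedDiff_le_diffSup _ _ _ _

end Averaging

/-! ### Exponentials and logarithms of formal power series -/

section Formal

open PowerSeries

variable {A : Type*} [CommRing A]

/-- `E` is the formal exponential of `L`, a power series without constant term. This is expressed
by the differential equation `E' = L' E` with `E(0) = 1`, which makes uniqueness and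
multiplicativity immediate. -/
structure IsFormalExp (L E : A⟦X⟧) : Prop where
  constantCoeff_left : constantCoeff L = 0
  constantCoeff_right : constantCoeff E = 1
  derivative_eq : d⁄dX A E = d⁄dX A L * E

theorem IsFormalExp.add {L₁ L₂ E₁ E₂ : A⟦X⟧} (h₁ : IsFormalExp L₁ E₁) (h₂ : IsFormalExp L₂ E₂) :
    IsFormalExp (L₁ + L₂) (E₁ * E₂) where
  constantCoeff_left := by simp [h₁.constantCoeff_left, h₂.constantCoeff_left]
  constantCoeff_right := by simp [h₁.constantCoeff_right, h₂.constantCoeff_right]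
  derivative_eq := by
    rw [Derivation.leibniz, h₁.derivative_eq, h₂.derivative_eq, map_add]
    simp only [smul_eq_mul]
    ring

theorem IsFormalExp.left_unique [IsAddTorsionFree A] {L₁ L₂ E : A⟦X⟧} (h₁ : IsFormalExp L₁ E)
    (h₂ : IsFormalExp L₂ E) : L₁ = L₂ := by
  have hE : IsUnit E := isUnit_iff_constantCoeff.2 (by simp [h₁.constantCoeff_right])
  refine derivative.ext (hE.mul_right_cancel ?_) ?_
  · rw [← h₁.derivative_eq, ← h₂.derivative_eq]
  · rw [h₁.constantCoeff_left, h₂.constantCoeff_left]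

theorem IsFormalExp.map {B : Type*} [CommRing B] (e : A →+* B) {L E : A⟦X⟧}
    (h : IsFormalExp L E) : IsFormalExp (L.map e) (E.map e) where
  constantCoeff_left := by
    rw [← coeff_zero_eq_constantCoeff_apply, coeff_map, coeff_zero_eq_constantCoeff_apply,
      h.constantCoeff_left, map_zero]
  constantCoeff_right := by
    rw [← coeff_zero_eq_constantCoeff_apply, coeff_map, coeff_zero_eq_constantCoeff_apply,
      h.constantCoeff_right, map_one]
  derivative_eq := by
    have hd : ∀ F : A⟦X⟧, d⁄dX B (F.map e) = (d⁄dX A F).map e := by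
      intro F
      ext n
      simp [coeff_derivative]
    rw [hd, hd, h.derivative_eq, map_mul]

variable [Algebra ℚ A]

theorem isFormalExp_exp {L : A⟦X⟧} (hL : constantCoeff L = 0) :
    IsFormalExp L ((exp A).subst L) where
  constantCoeff_left := hL
  constantCoeff_right := by
    have h := HasSubst.of_constantCoeff_zero' hL
    have h1 : exp A = 1 + (exp A - 1) := by ring
    have h2 : MvPowerSeries.constantCoeff ((exp A - 1).subst L) = 0 :=
      constantCoeff_subst_eq_zero hL _ (by simp)
    have h3 : (1 : A⟦X⟧).subst L = (1 : A⟦X⟧) := by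
      rw [← coe_substAlgHom h, map_one]
    rw [h1, subst_add h, map_add, h3]
    change constantCoeff 1 + MvPowerSeries.constantCoeff ((exp A - 1).subst L) = 1
    rw [h2, map_one, add_zero]
  derivative_eq := by
    rw [derivative_subst (HasSubst.of_constantCoeff_zero' hL), derivative_exp, mul_comm]

theorem isFormalExp_log {Q : A⟦X⟧} (hQ : constantCoeff Q = 0) :
    IsFormalExp ((log A).subst Q) (1 + Q) where
  constantCoeff_left := constantCoeff_subst_eq_zero hQ _ constantCoeff_log
  constantCoeff_right := by simp [hQ]
  derivative_eq := by
    have h := HasSubst.of_constantCoeff_zero' hQ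
    have h1 : d⁄dX A (log A) * (1 + X) = 1 := by
      ext n
      rw [deriv_log, mul_add, mul_one, map_add]
      cases n with
      | zero => simp
      | succ n =>
        rw [coeff_succ_mul_X, coeff_mk, coeff_mk, ← map_add, pow_succ, coeff_one]
        simp
    have h2 : (d⁄dX A (log A)).subst Q * (1 + Q) = (1 : A⟦X⟧) := by
      have := congrArg (substAlgHom h) h1
      rwa [map_mul, map_add, map_one, coe_substAlgHom, subst_X h] at this
    rw [derivative_subst h, map_add, derivative_one, zero_add, mul_right_comm, h2, one_mul]

theorem IsFormalExp.right_unique [IsAddTorsionFree A] {L E₁ E₂ : A⟦X⟧} (h₁ : IsFormalExp L E₁)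
    (h₂ : IsFormalExp L E₂) : E₁ = E₂ := by
  have hF := isFormalExp_exp (A := A) (L := -L) (by simp [h₁.constantCoeff_left])
  have key : ∀ {E : A⟦X⟧}, IsFormalExp L E → E * (exp A).subst (-L) = 1 := by
    intro E hE
    have h := hE.add hF
    refine derivative.ext ?_ (by rw [h.constantCoeff_right, map_one])
    rw [h.derivative_eq, add_neg_cancel, map_zero, zero_mul, derivative_one]
  have hu : IsUnit ((exp A).subst (-L) : A⟦X⟧) :=
    isUnit_iff_constantCoeff.2 (by simp [hF.constantCoeff_right])
  exact hu.mul_right_cancel ((key h₁).trans (key h₂).symm)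

end Formal

section

variable {n : ℕ} {S : Fin n → Type*} [∀ i, MeasurableSpace (S i)]

instance : IsAddTorsionFree (boundedMeasurable S) :=
  Subtype.val_injective.isAddTorsionFree (boundedMeasurable S).val.toAddMonoidHom

end

/-! ### Weighted sums of mixed differences of the coefficients -/

section WeightedSums

open PowerSeries Finset

variable {n : ℕ} {S : Fin n → Type*} [∀ i, MeasurableSpace (S i)]

/-- The sum of `w r V * Δ_V(F_r)` over all orders `r` and all sets `V` of coordinates, for a formal
power series `F = ∑ F_r X^r` whose coefficients are bounded measurable functions. -/
def weightedSum (w : ℕ → Finset (Fin n) → ℝ≥0∞) (F : (boundedMeasurable S)⟦X⟧) : ℝ≥0∞ :=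
  ∑' r, ∑ V, w r V * diffSup V (coeff r F).1

theorem weightedSum_mono {w₁ w₂ : ℕ → Finset (Fin n) → ℝ≥0∞} {F G : (boundedMeasurable S)⟦X⟧}
    (h : ∀ r V, w₁ r V * diffSup V (coeff r F).1 ≤ w₂ r V * diffSup V (coeff r G).1) :
    weightedSum w₁ F ≤ weightedSum w₂ G :=
  ENNReal.tsum_le_tsum fun r => sum_le_sum fun V _ => h r V

theorem weightedSum_add_le (w : ℕ → Finset (Fin n) → ℝ≥0∞) (F G : (boundedMeasurable S)⟦X⟧) :
    weightedSum w (F + G) ≤ weightedSum w F + weightedSum w G := by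
  rw [weightedSum, weightedSum, weightedSum, ← ENNReal.tsum_add]
  refine ENNReal.tsum_le_tsum fun r => ?_
  rw [← sum_add_distrib]
  refine sum_le_sum fun V _ => ?_
  rw [← mul_add, map_add]
  exact mul_le_mul_right (diffSup_add_le V _ _) _

/-- A single term is at most the whole weighted sum. -/
theorem mul_diffSup_le_weightedSum (w : ℕ → Finset (Fin n) → ℝ≥0∞)
    (F : (boundedMeasurable S)⟦X⟧) (r : ℕ) (V : Finset (Fin n)) :
    w r V * diffSup V (coeff r F).1 ≤ weightedSum w F :=
  (single_le_sum (f := fun V => w r V * diffSup V (coeff r F).1) (fun _ _ => zero_le)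
    (mem_univ V)).trans
    (ENNReal.le_tsum (f := fun r => ∑ V, w r V * diffSup V (coeff r F).1) r)

theorem coeff_subst_eq_sum {A : Type*} [CommRing A] (f b : A⟦X⟧) (hb : constantCoeff b = 0)
    (r : ℕ) : coeff r (f.subst b) = ∑ p ∈ range (r + 1), coeff p f * coeff r (b ^ p) := by
  rw [coeff_subst' (HasSubst.of_constantCoeff_zero' hb)]
  refine finsum_eq_sum_of_support_subset _ fun p hp => ?_
  rw [coe_range, Set.mem_Iio]
  by_contra h
  refine hp ?_
  change coeff p f • coeff r (b ^ p) = 0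
  rw [coeff_of_lt_order r, smul_zero]
  refine lt_of_lt_of_le ?_ (le_order_pow_of_constantCoeff_eq_zero p hb)
  exact_mod_cast (by omega : r < p)

theorem weightedSum_subst_le (w : ℕ → Finset (Fin n) → ℝ≥0∞) (f b : (boundedMeasurable S)⟦X⟧)
    (q : ℕ → ℝ) (hq : ∀ p, coeff p f = algebraMap ℝ _ (q p)) (hb : constantCoeff b = 0) :
    weightedSum w (f.subst b) ≤ ∑' p, ‖q p‖ₑ * weightedSum w (b ^ p) := by
  have h1 : ∀ r V, diffSup V (coeff r (f.subst b)).1 ≤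
      ∑' p, ‖q p‖ₑ * diffSup V (coeff r (b ^ p)).1 := by
    intro r V
    have h2 : (coeff r (f.subst b) : boundedMeasurable S).1 =
        ∑ p ∈ range (r + 1), q p • (coeff r (b ^ p)).1 := by
      rw [coeff_subst_eq_sum f b hb]
      simp only [hq, ← Algebra.smul_def]
      exact map_sum (boundedMeasurable S).val _ _
    rw [h2]
    refine (diffSup_sum_le _ V _).trans ?_
    refine (sum_le_sum fun p _ => diffSup_smul_le V (q p) _).trans ?_
    exact ENNReal.sum_le_tsum _
  calc weightedSum w (f.subst b)
      ≤ ∑' r, ∑ V, w r V * ∑' p, ‖q p‖ₑ * diffSup V (coeff r (b ^ p)).1 :=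
        ENNReal.tsum_le_tsum fun r => sum_le_sum fun V _ => mul_le_mul_right (h1 r V) _
    _ = ∑' r, ∑' p, ∑ V, ‖q p‖ₑ * (w r V * diffSup V (coeff r (b ^ p)).1) := by
        refine tsum_congr fun r => ?_
        rw [Summable.tsum_finsetSum fun _ _ => ENNReal.summable]
        refine sum_congr rfl fun V _ => ?_
        rw [← ENNReal.tsum_mul_left]
        exact tsum_congr fun p => by ring
    _ = ∑' p, ‖q p‖ₑ * weightedSum w (b ^ p) := by
        rw [ENNReal.tsum_comm]
        refine tsum_congr fun p => ?_
        simp only [weightedSum, ← mul_sum, ENNReal.tsum_mul_left]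

/-- Summing over all pairs `U ⊆ V` is bounded by summing over all pairs of sets `U`, `V \ U`. -/
theorem sum_powerset_sdiff_le {α : Type*} [Fintype α] [DecidableEq α]
    (H : Finset α → Finset α → ℝ≥0∞) :
    ∑ V : Finset α, ∑ U ∈ V.powerset, H U (V \ U) ≤ ∑ U, ∑ W, H U W := by
  rw [sum_sigma', ← sum_product' univ univ H]
  rw [← sum_image (f := fun p : Finset α × Finset α => H p.1 p.2)
    (g := fun p : (_ : Finset α) × Finset α => (p.2, p.1 \ p.2))]
  · exact sum_le_sum_of_subset (subset_univ _)
  · rintro ⟨V, U⟩ h ⟨V', U'⟩ h' heq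
    simp only [coe_sigma, Set.mem_sigma_iff, mem_coe, mem_powerset] at h h'
    simp only [Prod.mk.injEq] at heq
    obtain ⟨rfl, h3⟩ := heq
    have : V = V' := by
      rw [← union_sdiff_of_subset h.2, ← union_sdiff_of_subset h'.2, h3]
    rw [this]

theorem tsum_sum_antidiagonal (H : ℕ → ℕ → ℝ≥0∞) :
    ∑' r, ∑ p ∈ antidiagonal r, H p.1 p.2 = ∑' a, ∑' b, H a b := by
  rw [← ENNReal.tsum_prod, ← HasAntidiagonal.sigmaAntidiagonalEquivProd.tsum_eq,
    ENNReal.tsum_sigma']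
  refine tsum_congr fun r => ?_
  rw [tsum_fintype, ← sum_coe_sort]
  rfl

/-- The Leibniz rule for weighted sums: splittings of the weight `w` give bounds for the weighted
sum of a product of two series without constant term. -/
theorem weightedSum_mul_le {w w₁ w₂ w₃ w₄ : ℕ → Finset (Fin n) → ℝ≥0∞}
    (hw : ∀ a b U V, 0 < a → 0 < b → Disjoint U V →
      w (a + b) (U ∪ V) ≤ w₁ a U * w₂ b V + w₃ a U * w₄ b V)
    {F G : (boundedMeasurable S)⟦X⟧} (hF : constantCoeff F = 0) (hG : constantCoeff G = 0) :
    weightedSum w (F * G) ≤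
      weightedSum w₁ F * weightedSum w₂ G + weightedSum w₃ F * weightedSum w₄ G := by
  have hterm : ∀ a b U V, Disjoint U V →
      w (a + b) (U ∪ V) * (diffSup U (coeff a F).1 * diffSup V (coeff b G).1) ≤
      (w₁ a U * diffSup U (coeff a F).1) * (w₂ b V * diffSup V (coeff b G).1) +
      (w₃ a U * diffSup U (coeff a F).1) * (w₄ b V * diffSup V (coeff b G).1) := by
    intro a b U V hUV
    rcases Nat.eq_zero_or_pos a with rfl | ha
    · have : (coeff 0 F).1 = 0 := by rw [coeff_zero_eq_constantCoeff_apply, hF]; rfl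
      rw [this, diffSup_zero]
      simp
    rcases Nat.eq_zero_or_pos b with rfl | hb
    · have : (coeff 0 G).1 = 0 := by rw [coeff_zero_eq_constantCoeff_apply, hG]; rfl
      rw [this, diffSup_zero]
      simp
    refine (mul_le_mul_left (hw a b U V ha hb hUV) _).trans (le_of_eq ?_)
    ring
  let ψ : ℕ → ℕ → Finset (Fin n) → Finset (Fin n) → ℝ≥0∞ := fun a b U V =>
      (w₁ a U * diffSup U (coeff a F).1) * (w₂ b V * diffSup V (coeff b G).1) +
      (w₃ a U * diffSup U (coeff a F).1) * (w₄ b V * diffSup V (coeff b G).1)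
  calc weightedSum w (F * G)
      ≤ ∑' r, ∑ V, ∑ p ∈ antidiagonal r, ∑ U ∈ V.powerset, ψ p.1 p.2 U (V \ U) := by
        refine ENNReal.tsum_le_tsum fun r => sum_le_sum fun V _ => ?_
        have h1 : (coeff r (F * G)).1 =
            ∑ p ∈ antidiagonal r, (coeff p.1 F).1 * (coeff p.2 G).1 := by
          rw [coeff_mul]
          exact map_sum (boundedMeasurable S).val _ _
        rw [h1]
        refine (mul_le_mul_right ((diffSup_sum_le _ V _).trans
          (sum_le_sum fun p _ => diffSup_mul_le V _ _)) _).trans ?_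
        rw [mul_sum]
        refine sum_le_sum fun p hp => ?_
        rw [mul_sum]
        refine sum_le_sum fun U hU => ?_
        have h2 := hterm p.1 p.2 U (V \ U) disjoint_sdiff
        rwa [mem_antidiagonal.1 hp, union_sdiff_of_subset (mem_powerset.1 hU)] at h2
    _ = ∑' r, ∑ p ∈ antidiagonal r, ∑ V, ∑ U ∈ V.powerset, ψ p.1 p.2 U (V \ U) :=
        tsum_congr fun r => sum_comm
    _ ≤ ∑' r, ∑ p ∈ antidiagonal r, ∑ U, ∑ V, ψ p.1 p.2 U V :=
        ENNReal.tsum_le_tsum fun r => sum_le_sum fun p _ => sum_powerset_sdiff_le _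
    _ = ∑' a, ∑' b, ∑ U, ∑ V, ψ a b U V :=
        tsum_sum_antidiagonal fun a b => ∑ U, ∑ V, ψ a b U V
    _ = weightedSum w₁ F * weightedSum w₂ G + weightedSum w₃ F * weightedSum w₄ G := by
        simp only [ψ, sum_add_distrib, ← mul_sum, ← sum_mul, ENNReal.tsum_add,
          ENNReal.tsum_mul_left, ENNReal.tsum_mul_right, weightedSum]

end WeightedSums

/-! ### Weighted sums of powers, exponentials and logarithms -/

section PowerBounds

open PowerSeries Finset

variable {n : ℕ} {S : Fin n → Type*} [∀ i, MeasurableSpace (S i)]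

/-- `w'` is dominated by products of the weights `w`, in positive orders and for disjoint sets. -/
def SubmultiplicativeWeight (w w' : ℕ → Finset (Fin n) → ℝ≥0∞) : Prop :=
  ∀ a b U V, 0 < a → 0 < b → Disjoint U V → w' (a + b) (U ∪ V) ≤ w a U * w b V

/-- `d'` obeys a Leibniz rule with respect to the weights `w` and `d`, in positive orders and for
disjoint sets. -/
def LeibnizWeight (w d d' : ℕ → Finset (Fin n) → ℝ≥0∞) : Prop :=
  ∀ a b U V, 0 < a → 0 < b → Disjoint U V →
    d' (a + b) (U ∪ V) ≤ d a U * w b V + w a U * d b V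

variable {w w' d d' : ℕ → Finset (Fin n) → ℝ≥0∞} {F : (boundedMeasurable S)⟦X⟧}

theorem SubmultiplicativeWeight.mul_le (hw : SubmultiplicativeWeight w w')
    {F G : (boundedMeasurable S)⟦X⟧} (hF : constantCoeff F = 0) (hG : constantCoeff G = 0) :
    weightedSum w' (F * G) ≤ weightedSum w F * weightedSum w G := by
  have h := weightedSum_mul_le (w := w') (w₁ := w) (w₂ := w) (w₃ := 0) (w₄ := 0)
    (fun a b U V ha hb hUV => by simpa using hw a b U V ha hb hUV) hF hG
  have h0 : weightedSum 0 F = 0 := by simp [weightedSum]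
  rwa [h0, zero_mul, add_zero] at h

theorem SubmultiplicativeWeight.pow_le (hw : SubmultiplicativeWeight w w)
    (hF : constantCoeff F = 0) (p : ℕ) :
    weightedSum w (F ^ (p + 1)) ≤ weightedSum w F ^ (p + 1) := by
  induction p with
  | zero => simp
  | succ p ih =>
    rw [pow_succ, pow_succ _ (p + 1)]
    exact (hw.mul_le (by simp [hF]) hF).trans (mul_le_mul_left ih _)

/-- Powers with at least two factors are controlled for the larger weights `w'` as well. -/
theorem SubmultiplicativeWeight.pow_le' (hw : SubmultiplicativeWeight w w)
    (hw' : SubmultiplicativeWeight w w') (hF : constantCoeff F = 0) (p : ℕ) :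
    weightedSum w' (F ^ (p + 2)) ≤ weightedSum w F ^ (p + 2) := by
  rw [pow_succ, pow_succ _ (p + 1)]
  exact (hw'.mul_le (by simp [hF]) hF).trans (mul_le_mul_left (hw.pow_le hF p) _)

theorem LeibnizWeight.pow_le (hw : SubmultiplicativeWeight w w) (hd : LeibnizWeight w d d)
    (hF : constantCoeff F = 0) (p : ℕ) :
    weightedSum d (F ^ (p + 1)) ≤ (p + 1 : ℕ) * weightedSum w F ^ p * weightedSum d F := by
  induction p with
  | zero => simp
  | succ p ih =>
    rw [pow_succ]
    refine (weightedSum_mul_le hd (by simp [hF]) hF).trans ?_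
    refine (add_le_add (mul_le_mul_left ih _) (mul_le_mul_left (hw.pow_le hF p) _)).trans_eq ?_
    push_cast
    ring

theorem LeibnizWeight.pow_le' (hw : SubmultiplicativeWeight w w) (hd : LeibnizWeight w d d)
    (hd' : LeibnizWeight w d d') (hF : constantCoeff F = 0) (p : ℕ) :
    weightedSum d' (F ^ (p + 2)) ≤ (p + 2 : ℕ) * weightedSum w F ^ (p + 1) * weightedSum d F := by
  rw [pow_succ]
  refine (weightedSum_mul_le hd' (by simp [hF]) hF).trans ?_
  refine (add_le_add (mul_le_mul_left (hd.pow_le hw hF p) _)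
    (mul_le_mul_left (hw.pow_le hF p) _)).trans_eq ?_
  push_cast
  ring

theorem tsum_eq_tsum_add_two {a : ℕ → ℝ≥0∞} (h0 : a 0 = 0) (h1 : a 1 = 0) :
    ∑' p, a p = ∑' p, a (p + 2) := by
  rw [tsum_eq_zero_add' ENNReal.summable, tsum_eq_zero_add' ENNReal.summable, h0, h1, zero_add,
    zero_add]

theorem tsum_eq_tsum_add_one {a : ℕ → ℝ≥0∞} (h0 : a 0 = 0) :
    ∑' p, a p = ∑' p, a (p + 1) := by
  rw [tsum_eq_zero_add' ENNReal.summable, h0, zero_add]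

theorem tsum_geometric_le {r s : ℝ≥0∞} (h : r + s ≤ 1) : ∑' p : ℕ, r ^ p ≤ s⁻¹ := by
  rw [ENNReal.tsum_geometric]
  refine ENNReal.inv_le_inv.2 (ENNReal.le_sub_of_add_le_left ?_ h)
  exact ne_top_of_le_ne_top ENNReal.one_ne_top (le_self_add.trans h)

/-- The coefficients of `exp X - 1 - X`. -/
def expRemainderCoeff (p : ℕ) : ℝ := if p < 2 then 0 else 1 / (p ! : ℝ)

/-- The coefficients of `log (1 + X)`. -/
def logCoeff (p : ℕ) : ℝ := if p = 0 then 0 else (-1) ^ (p + 1) / p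

theorem coeff_expRemainder (p : ℕ) :
    coeff p (exp (boundedMeasurable S) - 1 - X) = algebraMap ℝ _ (expRemainderCoeff p) := by
  rw [map_sub, map_sub, coeff_exp, coeff_one, coeff_X, expRemainderCoeff,
    IsScalarTower.algebraMap_apply ℚ ℝ (boundedMeasurable S)]
  rcases p with _ | _ | p
  · simp
  · simp
  · simp

theorem coeff_log_eq (p : ℕ) :
    coeff p (log (boundedMeasurable S)) = algebraMap ℝ _ (logCoeff p) := by
  rw [coeff_log, logCoeff, IsScalarTower.algebraMap_apply ℚ ℝ (boundedMeasurable S)]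
  split_ifs <;> simp

theorem enorm_expRemainderCoeff_le (p : ℕ) : ‖expRemainderCoeff (p + 2)‖ₑ ≤ 2⁻¹ := by
  have h : expRemainderCoeff (p + 2) ≤ 2⁻¹ := by
    rw [expRemainderCoeff, if_neg (by omega), one_div]
    refine inv_anti₀ (by norm_num) ?_
    exact_mod_cast (Nat.factorial_le (show 2 ≤ p + 2 by omega) : 2 ! ≤ (p + 2)!)
  rw [Real.enorm_of_nonneg (by rw [expRemainderCoeff]; positivity)]
  refine (ENNReal.ofReal_le_ofReal h).trans_eq ?_
  rw [ENNReal.ofReal_inv_of_pos (by norm_num)]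
  simp

theorem enorm_expRemainderCoeff_mul_le (p : ℕ) :
    ‖expRemainderCoeff (p + 2)‖ₑ * (p + 2 : ℕ) ≤ 1 := by
  rw [Real.enorm_of_nonneg (by rw [expRemainderCoeff]; positivity), ← ENNReal.ofReal_natCast,
    ← ENNReal.ofReal_mul (by rw [expRemainderCoeff]; positivity), ENNReal.ofReal_le_one,
    expRemainderCoeff, if_neg (by omega), one_div, inv_mul_le_iff₀ (by positivity), mul_one]
  exact_mod_cast Nat.self_le_factorial _

theorem enorm_logCoeff_mul_le (p : ℕ) : ‖logCoeff (p + 1)‖ₑ * (p + 1 : ℕ) ≤ 1 := by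
  have h : |logCoeff (p + 1)| = ((p + 1 : ℕ) : ℝ)⁻¹ := by
    rw [logCoeff, if_neg (by omega), abs_div, abs_pow, abs_neg, abs_one, one_pow, one_div,
      Nat.abs_cast]
  rw [Real.enorm_eq_ofReal_abs, h, ← ENNReal.ofReal_natCast, ← ENNReal.ofReal_mul (by positivity),
    inv_mul_cancel₀ (by positivity), ENNReal.ofReal_one]

theorem enorm_logCoeff_le (p : ℕ) : ‖logCoeff (p + 1)‖ₑ ≤ 1 := by
  refine le_trans ?_ (enorm_logCoeff_mul_le p)
  exact le_mul_of_one_le_right' (by exact_mod_cast Nat.succ_pos p)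

/-- Here `1/100 = (1/2) (1/10)^2 (1 + 1/2 + 1/4 + ⋯)` is a crude bound for `e^{1/10} - 1 - 1/10`. -/
theorem weightedSum_expRemainder_le (hw : SubmultiplicativeWeight w w)
    (hw' : SubmultiplicativeWeight w w') (hF : constantCoeff F = 0)
    (h : weightedSum w F ≤ 10⁻¹) :
    weightedSum w' ((exp (boundedMeasurable S) - 1 - X).subst F) ≤ 100⁻¹ := by
  refine (weightedSum_subst_le w' _ F _ coeff_expRemainder hF).trans ?_
  rw [tsum_eq_tsum_add_two (by simp [expRemainderCoeff]) (by simp [expRemainderCoeff])]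
  calc ∑' p, ‖expRemainderCoeff (p + 2)‖ₑ * weightedSum w' (F ^ (p + 2))
      ≤ ∑' p : ℕ, (2⁻¹ * 10⁻¹ ^ 2) * 10⁻¹ ^ p := by
        refine ENNReal.tsum_le_tsum fun p => ?_
        refine (mul_le_mul' (enorm_expRemainderCoeff_le p) ((hw.pow_le' hw' hF p).trans
          (pow_le_pow_left' h _))).trans_eq ?_
        ring
    _ ≤ (2⁻¹ * 10⁻¹ ^ 2) * 2⁻¹⁻¹ := by
        rw [ENNReal.tsum_mul_left]
        refine mul_le_mul_right (tsum_geometric_le ?_) _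
        have : (10⁻¹ + 2⁻¹ : NNReal) ≤ 1 := by
          rw [← NNReal.coe_le_coe]; push_cast; norm_num
        have h2 := ENNReal.coe_le_coe.2 this
        push_cast at h2
        simpa using h2
    _ = 100⁻¹ := by
        have : (2⁻¹ * 10⁻¹ ^ 2 * 2⁻¹⁻¹ : NNReal) = 100⁻¹ := by
          rw [← NNReal.coe_inj]; push_cast; norm_num
        have h2 := congrArg (fun x : NNReal => (x : ℝ≥0∞)) this
        push_cast at h2
        simpa using h2

/-- The derivative of `exp x - 1 - x` is `exp x - 1`, which is at most `1/5` at `x = 1/10`. -/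
theorem weightedSum_expRemainder_le' (hw : SubmultiplicativeWeight w w)
    (hd : LeibnizWeight w d d) (hd' : LeibnizWeight w d d') (hF : constantCoeff F = 0)
    (h : weightedSum w F ≤ 10⁻¹) :
    weightedSum d' ((exp (boundedMeasurable S) - 1 - X).subst F) ≤ 5⁻¹ * weightedSum d F := by
  refine (weightedSum_subst_le d' _ F _ coeff_expRemainder hF).trans ?_
  rw [tsum_eq_tsum_add_two (by simp [expRemainderCoeff]) (by simp [expRemainderCoeff])]
  calc ∑' p, ‖expRemainderCoeff (p + 2)‖ₑ * weightedSum d' (F ^ (p + 2))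
      ≤ ∑' p : ℕ, (10⁻¹ * weightedSum d F) * 10⁻¹ ^ p := by
        refine ENNReal.tsum_le_tsum fun p => ?_
        calc ‖expRemainderCoeff (p + 2)‖ₑ * weightedSum d' (F ^ (p + 2))
            ≤ ‖expRemainderCoeff (p + 2)‖ₑ *
                ((p + 2 : ℕ) * 10⁻¹ ^ (p + 1) * weightedSum d F) := by
              refine mul_le_mul_right ((hd.pow_le' hw hd' hF p).trans ?_) _
              gcongr
          _ = (‖expRemainderCoeff (p + 2)‖ₑ * (p + 2 : ℕ)) *
                ((10⁻¹ * weightedSum d F) * 10⁻¹ ^ p) := by ring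
          _ ≤ 1 * ((10⁻¹ * weightedSum d F) * 10⁻¹ ^ p) :=
              mul_le_mul_left (enorm_expRemainderCoeff_mul_le p) _
          _ = _ := one_mul _
    _ ≤ (10⁻¹ * weightedSum d F) * 2⁻¹⁻¹ := by
        rw [ENNReal.tsum_mul_left]
        refine mul_le_mul_right (tsum_geometric_le ?_) _
        have : (10⁻¹ + 2⁻¹ : NNReal) ≤ 1 := by
          rw [← NNReal.coe_le_coe]; push_cast; norm_num
        have h2 := ENNReal.coe_le_coe.2 this
        push_cast at h2
        simpa using h2
    _ = 5⁻¹ * weightedSum d F := by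
        have : (10⁻¹ * 2⁻¹⁻¹ : NNReal) = 5⁻¹ := by
          rw [← NNReal.coe_inj]; push_cast; norm_num
        have h2 := congrArg (fun x : NNReal => (x : ℝ≥0∞)) this
        push_cast at h2
        rw [mul_right_comm]
        congr 1
        simpa using h2

theorem tsum_geometric_hundredth_le : ∑' p : ℕ, (100⁻¹ : ℝ≥0∞) ^ p ≤ 5 / 4 := by
  have : (100⁻¹ + 4 / 5 : NNReal) ≤ 1 := by
    rw [← NNReal.coe_le_coe]; push_cast; norm_num
  have h2 := ENNReal.coe_le_coe.2 this
  refine (tsum_geometric_le (s := 4 / 5) ?_).trans_eq ?_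
  · push_cast at h2
    simpa using h2
  · rw [ENNReal.inv_div (by simp) (by simp)]

theorem weightedSum_log_le (hw : SubmultiplicativeWeight w w) (hF : constantCoeff F = 0)
    (h : weightedSum w F ≤ 100⁻¹) :
    weightedSum w ((log (boundedMeasurable S)).subst F) ≤ 80⁻¹ := by
  refine (weightedSum_subst_le w _ F _ coeff_log_eq hF).trans ?_
  rw [tsum_eq_tsum_add_one (by simp [logCoeff])]
  calc ∑' p, ‖logCoeff (p + 1)‖ₑ * weightedSum w (F ^ (p + 1))
      ≤ ∑' p : ℕ, 100⁻¹ * 100⁻¹ ^ p := by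
        refine ENNReal.tsum_le_tsum fun p => ?_
        refine (mul_le_mul' (enorm_logCoeff_le p) ((hw.pow_le hF p).trans
          (pow_le_pow_left' h _))).trans_eq ?_
        ring
    _ ≤ 100⁻¹ * (5 / 4) := by
        rw [ENNReal.tsum_mul_left]
        exact mul_le_mul_right tsum_geometric_hundredth_le _
    _ = 80⁻¹ := by
        have : (100⁻¹ * (5 / 4) : NNReal) = 80⁻¹ := by
          rw [← NNReal.coe_inj]; push_cast; norm_num
        have h2 := congrArg (fun x : NNReal => (x : ℝ≥0∞)) this
        push_cast at h2
        simpa using h2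

theorem weightedSum_log_le' (hw : SubmultiplicativeWeight w w) (hd : LeibnizWeight w d d)
    (hF : constantCoeff F = 0) (h : weightedSum w F ≤ 100⁻¹) :
    weightedSum d ((log (boundedMeasurable S)).subst F) ≤ 5 / 4 * weightedSum d F := by
  refine (weightedSum_subst_le d _ F _ coeff_log_eq hF).trans ?_
  rw [tsum_eq_tsum_add_one (by simp [logCoeff])]
  calc ∑' p, ‖logCoeff (p + 1)‖ₑ * weightedSum d (F ^ (p + 1))
      ≤ ∑' p : ℕ, 100⁻¹ ^ p * weightedSum d F := by
        refine ENNReal.tsum_le_tsum fun p => ?_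
        calc ‖logCoeff (p + 1)‖ₑ * weightedSum d (F ^ (p + 1))
            ≤ ‖logCoeff (p + 1)‖ₑ * ((p + 1 : ℕ) * 100⁻¹ ^ p * weightedSum d F) := by
              refine mul_le_mul_right ((hd.pow_le hw hF p).trans ?_) _
              gcongr
          _ = (‖logCoeff (p + 1)‖ₑ * (p + 1 : ℕ)) * (100⁻¹ ^ p * weightedSum d F) := by ring
          _ ≤ 1 * (100⁻¹ ^ p * weightedSum d F) :=
              mul_le_mul_left (enorm_logCoeff_mul_le p) _
          _ = _ := one_mul _
    _ ≤ 5 / 4 * weightedSum d F := by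
        rw [ENNReal.tsum_mul_right]
        exact mul_le_mul_left tsum_geometric_hundredth_le _

end PowerBounds

/-! ### Eliminating one coordinate from a formal exponential -/

section Elimination

open PowerSeries

variable {n : ℕ} {S : Fin n → Type*} [∀ i, MeasurableSpace (S i)]

/-- Evaluation of a bounded measurable function at a point. -/
def evalAt (x : ∀ i, S i) : boundedMeasurable S →+* ℝ :=
  (Pi.evalRingHom (fun _ : ∀ i, S i => ℝ) x).comp (boundedMeasurable S).val.toRingHom

theorem evalAt_apply (x : ∀ i, S i) (F : boundedMeasurable S) : evalAt x F = F.1 x := rfl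

theorem coeff_map_evalAt (x : ∀ i, S i) (r : ℕ) (F : (boundedMeasurable S)⟦X⟧) :
    coeff r (F.map (evalAt x)) = (coeff r F).1 x := coeff_map _ _ _

theorem map_evalAt_subst (x : ∀ i, S i) (f b : (boundedMeasurable S)⟦X⟧)
    (hb : constantCoeff b = 0) :
    PowerSeries.map (evalAt x) (f.subst b) =
      (PowerSeries.map (evalAt x) f).subst (PowerSeries.map (evalAt x) b) :=
  map_subst (HasSubst.of_constantCoeff_zero' hb) f

variable (ν : ∀ i, Measure (S i)) [∀ i, IsProbabilityMeasure (ν i)] (c : Fin n)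

/-- Averaging the coefficients of a formal power series over the coordinate `c`. -/
def avgSeries : (boundedMeasurable S)⟦X⟧ →+ (boundedMeasurable S)⟦X⟧ where
  toFun F := PowerSeries.mk fun r => avg ν c (coeff r F)
  map_zero' := by ext; simp
  map_add' F G := by ext; simp

theorem coeff_avgSeries (r : ℕ) (F : (boundedMeasurable S)⟦X⟧) :
    coeff r (avgSeries ν c F) = avg ν c (coeff r F) :=
  coeff_mk r fun r => avg ν c (coeff r F)

theorem constantCoeff_avgSeries (F : (boundedMeasurable S)⟦X⟧) :
    constantCoeff (avgSeries ν c F) = avg ν c (constantCoeff F) := by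
  rw [← coeff_zero_eq_constantCoeff_apply, coeff_avgSeries, coeff_zero_eq_constantCoeff_apply]

theorem avgSeries_one : avgSeries ν c (1 : (boundedMeasurable S)⟦X⟧) = 1 := by
  ext1 r
  rw [coeff_avgSeries, coeff_one]
  split_ifs
  · exact avg_one ν c
  · exact map_zero _

theorem avgSeries_avgSeries (F : (boundedMeasurable S)⟦X⟧) :
    avgSeries ν c (avgSeries ν c F) = avgSeries ν c F := by
  ext1 r
  rw [coeff_avgSeries, coeff_avgSeries, avg_avg]

theorem avgSeries_sub_self (F : (boundedMeasurable S)⟦X⟧) :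
    avgSeries ν c (F - avgSeries ν c F) = 0 := by
  rw [map_sub, avgSeries_avgSeries, sub_self]

theorem map_evalAt_avgSeries (F : (boundedMeasurable S)⟦X⟧) (x : ∀ i, S i) (u : S c) :
    (avgSeries ν c F).map (evalAt (Function.update x c u)) =
      (avgSeries ν c F).map (evalAt x) := by
  ext r
  rw [coeff_map_evalAt, coeff_map_evalAt, coeff_avgSeries, avg_update]

theorem avgSeries_mul_of_update {F : (boundedMeasurable S)⟦X⟧} (G : (boundedMeasurable S)⟦X⟧)
    (hF : ∀ x u, F.map (evalAt (Function.update x c u)) = F.map (evalAt x)) :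
    avgSeries ν c (F * G) = F * avgSeries ν c G := by
  ext1 r
  rw [coeff_avgSeries, coeff_mul, coeff_mul, map_sum]
  refine Finset.sum_congr rfl fun p _ => ?_
  rw [coeff_avgSeries]
  refine avg_mul_of_update ν c _ fun x u => ?_
  rw [← coeff_map_evalAt, ← coeff_map_evalAt, hF]

/-- The series `E_c[exp h - 1 - h]`. -/
def expRemainder (h : (boundedMeasurable S)⟦X⟧) : (boundedMeasurable S)⟦X⟧ :=
  avgSeries ν c ((exp (boundedMeasurable S) - 1 - X).subst h)

/-- The series `log (1 + E_c[exp h - 1 - h])`; it equals `log E_c[exp h]` if `E_c h = 0`. -/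
def logCorrection (h : (boundedMeasurable S)⟦X⟧) : (boundedMeasurable S)⟦X⟧ :=
  (log (boundedMeasurable S)).subst (expRemainder ν c h)

/-- The series `log E_c[exp g]`, written as `E_c g + log E_c[exp (g - E_c g)]`. -/
def eliminate (g : (boundedMeasurable S)⟦X⟧) : (boundedMeasurable S)⟦X⟧ :=
  avgSeries ν c g + logCorrection ν c (g - avgSeries ν c g)

variable {ν c} {h : (boundedMeasurable S)⟦X⟧}

theorem constantCoeff_expRemainder (h0 : constantCoeff h = 0) :
    constantCoeff (expRemainder ν c h) = 0 := by
  rw [expRemainder, constantCoeff_avgSeries]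
  have : constantCoeff ((exp (boundedMeasurable S) - 1 - X).subst h :
      (boundedMeasurable S)⟦X⟧) = 0 :=
    constantCoeff_subst_eq_zero h0 _ (by simp)
  rw [this, map_zero]

theorem one_add_expRemainder (h0 : constantCoeff h = 0) (hh : avgSeries ν c h = 0) :
    1 + expRemainder ν c h = avgSeries ν c ((exp (boundedMeasurable S)).subst h) := by
  have hs := HasSubst.of_constantCoeff_zero' h0
  have : ((exp (boundedMeasurable S) - 1 - X).subst h : (boundedMeasurable S)⟦X⟧) =
      (exp (boundedMeasurable S)).subst h - 1 - h := by
    rw [← coe_substAlgHom hs, map_sub, map_sub, map_one, coe_substAlgHom, subst_X hs]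
  rw [expRemainder, this, map_sub, map_sub, avgSeries_one, hh]
  ring

theorem isFormalExp_logCorrection (h0 : constantCoeff h = 0) (hh : avgSeries ν c h = 0) :
    IsFormalExp (logCorrection ν c h) (avgSeries ν c ((exp (boundedMeasurable S)).subst h)) := by
  rw [← one_add_expRemainder h0 hh]
  exact isFormalExp_log (constantCoeff_expRemainder h0)

theorem map_evalAt_logCorrection (h0 : constantCoeff h = 0) (x : ∀ i, S i) (u : S c) :
    (logCorrection ν c h).map (evalAt (Function.update x c u)) =
      (logCorrection ν c h).map (evalAt x) := by
  have hQ := constantCoeff_expRemainder (ν := ν) (c := c) h0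
  rw [logCorrection, map_evalAt_subst _ _ _ hQ, map_evalAt_subst _ _ _ hQ, map_log, map_log,
    expRemainder, map_evalAt_avgSeries]

theorem constantCoeff_sub_avgSeries {g : (boundedMeasurable S)⟦X⟧} (h0 : constantCoeff g = 0) :
    constantCoeff (g - avgSeries ν c g) = 0 := by
  rw [map_sub, constantCoeff_avgSeries, h0, map_zero, sub_zero]

/-- Elimination of a coordinate corresponds to averaging the formal exponential over it. -/
theorem IsFormalExp.eliminate {g E : (boundedMeasurable S)⟦X⟧} (hg : IsFormalExp g E) :
    IsFormalExp (eliminate ν c g) (avgSeries ν c E) := by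
  have h0 := hg.constantCoeff_left
  have ha : constantCoeff (avgSeries ν c g) = 0 := by rw [constantCoeff_avgSeries, h0, map_zero]
  have hc := constantCoeff_sub_avgSeries (ν := ν) (c := c) h0
  have h1 := isFormalExp_exp ha
  have hE : E = (exp (boundedMeasurable S)).subst (avgSeries ν c g) *
      (exp (boundedMeasurable S)).subst (g - avgSeries ν c g) := by
    refine hg.right_unique ?_
    have := h1.add (isFormalExp_exp hc)
    rwa [add_sub_cancel] at this
  rw [hE, avgSeries_mul_of_update]
  · exact h1.add (isFormalExp_logCorrection hc (avgSeries_sub_self ν c g))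
  · intro x u
    rw [map_evalAt_subst _ _ _ ha, map_evalAt_subst _ _ _ ha, map_exp, map_exp,
      map_evalAt_avgSeries]

theorem diffSup_coeff_eliminate {g : (boundedMeasurable S)⟦X⟧} (h0 : constantCoeff g = 0)
    {V : Finset (Fin n)} (hc : c ∈ V) (r : ℕ) :
    diffSup V (coeff r (CumulantExpansion.eliminate ν c g)).1 = 0 := by
  refine diffSup_eq_zero_of_mem hc fun x u => ?_
  rw [← coeff_map_evalAt, ← coeff_map_evalAt, CumulantExpansion.eliminate,
    map_add (PowerSeries.map _), map_add (PowerSeries.map _), map_evalAt_avgSeries, map_evalAt_logCorrection (constantCoeff_sub_avgSeries h0)]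

end Elimination

section EliminationBounds

open PowerSeries Finset

variable {n : ℕ} {S : Fin n → Type*} [∀ i, MeasurableSpace (S i)]
  {ν : ∀ i, Measure (S i)} [∀ i, IsProbabilityMeasure (ν i)] {c : Fin n}

theorem weightedSum_avgSeries_le (w : ℕ → Finset (Fin n) → ℝ≥0∞)
    (F : (boundedMeasurable S)⟦X⟧) : weightedSum w (avgSeries ν c F) ≤ weightedSum w F := by
  refine weightedSum_mono fun r V => mul_le_mul_right ?_ _
  rw [coeff_avgSeries]
  by_cases hc : c ∈ V
  · rw [diffSup_avg_eq_zero ν c hc]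
    exact zero_le
  · exact diffSup_avg_le ν c hc _

/-- The sets `V` avoiding `c`, weighted by `w₀`, and the sets `insert c V` which arise from centring
in the coordinate `c`, weighted by `w₁`, are jointly controlled by the weights `w₂`. -/
theorem weightedSum_add_sub_avgSeries_le {w₀ w₁ w₂ : ℕ → Finset (Fin n) → ℝ≥0∞}
    (h₀ : ∀ r V, c ∈ V → w₀ r V = 0) (h₁ : ∀ r V, c ∈ V → w₁ r V = 0)
    (h₀₂ : ∀ r V, c ∉ V → w₀ r V ≤ w₂ r V) (h₁₂ : ∀ r V, c ∉ V → w₁ r V ≤ w₂ r (insert c V))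
    (g : (boundedMeasurable S)⟦X⟧) :
    weightedSum w₀ g + weightedSum w₁ (g - avgSeries ν c g) ≤ weightedSum w₂ g := by
  rw [weightedSum, weightedSum, weightedSum, ← ENNReal.tsum_add]
  refine ENNReal.tsum_le_tsum fun r => ?_
  have hsplit : ∀ H : Finset (Fin n) → ℝ≥0∞, ∑ V, H V =
      ∑ V ∈ (univ.erase c).powerset, H V + ∑ V ∈ (univ.erase c).powerset, H (insert c V) := by
    intro H
    rw [← sum_powerset_insert (notMem_erase c univ), insert_erase (mem_univ c), powerset_univ]
  have hmem : ∀ V ∈ (univ.erase c).powerset, c ∉ V := fun V hV hc =>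
    notMem_erase c univ (mem_powerset.1 hV hc)
  rw [hsplit, hsplit (fun V => w₁ r V * _), hsplit (fun V => w₂ r V * _)]
  have e0 : ∑ V ∈ (univ.erase c).powerset,
      w₀ r (insert c V) * diffSup (insert c V) (coeff r g).1 = 0 :=
    sum_eq_zero fun V _ => by rw [h₀ r _ (mem_insert_self c V), zero_mul]
  have e1 : ∑ V ∈ (univ.erase c).powerset,
      w₁ r (insert c V) * diffSup (insert c V) (coeff r (g - avgSeries ν c g)).1 = 0 :=
    sum_eq_zero fun V _ => by rw [h₁ r _ (mem_insert_self c V), zero_mul]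
  rw [e0, e1, add_zero, add_zero]
  refine add_le_add (sum_le_sum fun V hV => mul_le_mul_left (h₀₂ r V (hmem V hV)) _)
    (sum_le_sum fun V hV => mul_le_mul' (h₁₂ r V (hmem V hV)) ?_)
  rw [map_sub, coeff_avgSeries]
  exact diffSup_sub_avg_le ν c (hmem V hV) _

variable {w w' d d' : ℕ → Finset (Fin n) → ℝ≥0∞} {h : (boundedMeasurable S)⟦X⟧}

theorem weightedSum_expRemainder_avg_le (hw : SubmultiplicativeWeight w w)
    (hw' : SubmultiplicativeWeight w w') (h0 : constantCoeff h = 0)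
    (hh : weightedSum w h ≤ 10⁻¹) : weightedSum w' (expRemainder ν c h) ≤ 100⁻¹ :=
  (weightedSum_avgSeries_le _ _).trans (weightedSum_expRemainder_le hw hw' h0 hh)

theorem weightedSum_logCorrection_le (hw' : SubmultiplicativeWeight w w')
    (hww' : ∀ r V, w r V ≤ w' r V) (h0 : constantCoeff h = 0) (hh : weightedSum w h ≤ 10⁻¹) :
    weightedSum w' (logCorrection ν c h) ≤ 80⁻¹ :=
  weightedSum_log_le
    (fun a b U V ha hb hUV => (hw' a b U V ha hb hUV).trans (mul_le_mul' (hww' _ _) (hww' _ _)))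
    (constantCoeff_expRemainder h0)
    (weightedSum_expRemainder_avg_le
      (fun a b U V ha hb hUV => (hww' _ _).trans (hw' a b U V ha hb hUV)) hw' h0 hh)

theorem weightedSum_logCorrection_le' (hw' : SubmultiplicativeWeight w w')
    (hww' : ∀ r V, w r V ≤ w' r V) (hd' : LeibnizWeight w d d') (hdd' : ∀ r V, d r V ≤ d' r V)
    (h0 : constantCoeff h = 0) (hh : weightedSum w h ≤ 10⁻¹) :
    weightedSum d' (logCorrection ν c h) ≤ 4⁻¹ * weightedSum d h := by
  have hw : SubmultiplicativeWeight w w :=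
    fun a b U V ha hb hUV => (hww' _ _).trans (hw' a b U V ha hb hUV)
  refine (weightedSum_log_le' (w := w') (d := d')
    (fun a b U V ha hb hUV => (hw' a b U V ha hb hUV).trans (mul_le_mul' (hww' _ _) (hww' _ _)))
    (fun a b U V ha hb hUV => (hd' a b U V ha hb hUV).trans (add_le_add
      (mul_le_mul' (hdd' _ _) (hww' _ _)) (mul_le_mul' (hww' _ _) (hdd' _ _))))
    (constantCoeff_expRemainder h0) (weightedSum_expRemainder_avg_le hw hw' h0 hh)).trans ?_
  refine (mul_le_mul_right ((weightedSum_avgSeries_le _ _).trans (weightedSum_expRemainder_le' hw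
    (fun a b U V ha hb hUV => (hdd' _ _).trans (hd' a b U V ha hb hUV)) hd' h0 hh)) _).trans_eq ?_
  have : (5 / 4 * 5⁻¹ : NNReal) = 4⁻¹ := by
    rw [← NNReal.coe_inj]; push_cast; norm_num
  have h2 := congrArg (fun x : NNReal => (x : ℝ≥0∞)) this
  push_cast at h2
  rw [← mul_assoc]
  congr 1
  simpa using h2

/-- The weight `τ^r 4^{-|V|}` on the sets `V` avoiding `c`, with `r + |V| ≤ ℓ`. -/
def centredWeight (τ : NNReal) (ℓ : ℕ) (c : Fin n) (r : ℕ) (V : Finset (Fin n)) : ℝ≥0∞ :=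
  if c ∉ V ∧ r + V.card ≤ ℓ then (τ : ℝ≥0∞) ^ r * 4⁻¹ ^ V.card else 0

/-- The weight `τ^r 4^{1-|V|}` on the sets `V` containing `j`, with `r + |V| ≤ ℓ`. -/
def anchoredWeight (τ : NNReal) (ℓ : ℕ) (j : Fin n) (r : ℕ) (V : Finset (Fin n)) : ℝ≥0∞ :=
  if j ∈ V ∧ r + V.card ≤ ℓ then (τ : ℝ≥0∞) ^ r * 4⁻¹ ^ (V.card - 1) else 0

/-- The restriction of `anchoredWeight` to the sets avoiding `c`. -/
def anchoredCentredWeight (τ : NNReal) (ℓ : ℕ) (j c : Fin n) (r : ℕ) (V : Finset (Fin n)) :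
    ℝ≥0∞ :=
  if j ∈ V ∧ c ∉ V ∧ r + V.card ≤ ℓ then (τ : ℝ≥0∞) ^ r * 4⁻¹ ^ (V.card - 1) else 0

theorem submultiplicativeWeight_centredWeight (τ : NNReal) (ℓ : ℕ) (c : Fin n) :
    SubmultiplicativeWeight (centredWeight τ ℓ c) (centredWeight τ (ℓ + 1) c) := by
  intro a b U V ha hb hUV
  unfold centredWeight
  rw [card_union_of_disjoint hUV]
  by_cases hc : c ∉ U ∪ V ∧ a + b + (U.card + V.card) ≤ ℓ + 1
  · rw [mem_union, not_or] at hc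
    rw [if_pos (by rw [mem_union, not_or]; exact hc), if_pos ⟨hc.1.1, by omega⟩,
      if_pos ⟨hc.1.2, by omega⟩]
    apply le_of_eq
    ring
  · rw [if_neg hc]
    exact zero_le

theorem centredWeight_le_succ (τ : NNReal) (ℓ : ℕ) (c : Fin n) (r : ℕ) (V : Finset (Fin n)) :
    centredWeight τ ℓ c r V ≤ centredWeight τ (ℓ + 1) c r V := by
  unfold centredWeight
  by_cases h : c ∉ V ∧ r + V.card ≤ ℓ
  · rw [if_pos h, if_pos ⟨h.1, by omega⟩]
  · rw [if_neg h]
    exact zero_le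

theorem anchoredCentredWeight_le_succ (τ : NNReal) (ℓ : ℕ) (j c : Fin n) (r : ℕ)
    (V : Finset (Fin n)) :
    anchoredCentredWeight τ ℓ j c r V ≤ anchoredCentredWeight τ (ℓ + 1) j c r V := by
  unfold anchoredCentredWeight
  by_cases h : j ∈ V ∧ c ∉ V ∧ r + V.card ≤ ℓ
  · rw [if_pos h, if_pos ⟨h.1, h.2.1, by omega⟩]
  · rw [if_neg h]
    exact zero_le

theorem leibnizWeight_anchoredCentredWeight (τ : NNReal) (ℓ : ℕ) (j c : Fin n) :
    LeibnizWeight (centredWeight τ ℓ c) (anchoredCentredWeight τ ℓ j c)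
      (anchoredCentredWeight τ (ℓ + 1) j c) := by
  intro a b U V ha hb hUV
  unfold centredWeight anchoredCentredWeight
  rw [card_union_of_disjoint hUV]
  by_cases hc : j ∈ U ∪ V ∧ c ∉ U ∪ V ∧ a + b + (U.card + V.card) ≤ ℓ + 1
  · rw [if_pos hc]
    obtain ⟨hj, hcn, hl⟩ := hc
    rw [mem_union, not_or] at hcn
    rcases mem_union.1 hj with hj | hj
    · refine le_add_right ?_
      rw [if_pos ⟨hj, hcn.1, by omega⟩, if_pos ⟨hcn.2, by omega⟩]
      have : U.card + V.card - 1 = (U.card - 1) + V.card := by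
        have := card_pos.2 ⟨j, hj⟩
        omega
      rw [this]
      apply le_of_eq
      ring
    · refine le_add_left ?_
      rw [if_pos ⟨hcn.1, by omega⟩, if_pos ⟨hj, hcn.2, by omega⟩]
      have : U.card + V.card - 1 = U.card + (V.card - 1) := by
        have := card_pos.2 ⟨j, hj⟩
        omega
      rw [this]
      apply le_of_eq
      ring
  · rw [if_neg hc]
    exact zero_le

variable {τ : NNReal} {ℓ : ℕ} {g : (boundedMeasurable S)⟦X⟧}

theorem weightedSum_sub_avgSeries_le :
    weightedSum (centredWeight τ ℓ c) (g - avgSeries ν c g) ≤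
      weightedSum (anchoredWeight τ (ℓ + 1) c) g := by
  refine le_trans ?_ (weightedSum_add_sub_avgSeries_le (ν := ν) (c := c) (w₀ := 0)
    (w₁ := centredWeight τ ℓ c) (fun _ _ _ => rfl) ?_ (fun _ _ _ => zero_le) ?_ g)
  · exact le_add_self
  · intro r V hc
    rw [centredWeight, if_neg (fun h => h.1 hc)]
  · intro r V hc
    unfold centredWeight anchoredWeight
    rw [card_insert_of_notMem hc]
    by_cases h : c ∉ V ∧ r + V.card ≤ ℓ
    · rw [if_pos h, if_pos ⟨mem_insert_self _ _, by omega⟩]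
      simp
    · rw [if_neg h]
      exact zero_le

theorem weightedSum_logCorrection_eliminate_le (h0 : constantCoeff g = 0)
    (hg : weightedSum (anchoredWeight τ (ℓ + 1) c) g ≤ 10⁻¹) :
    weightedSum (centredWeight τ (ℓ + 1) c) (logCorrection ν c (g - avgSeries ν c g)) ≤ 80⁻¹ :=
  weightedSum_logCorrection_le (submultiplicativeWeight_centredWeight τ ℓ c)
    (centredWeight_le_succ τ ℓ c) (constantCoeff_sub_avgSeries h0)
    (weightedSum_sub_avgSeries_le.trans hg)

/-- Eliminating a coordinate does not increase the anchored weighted sums: the new contributions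
at `V` are paid for by the differences of `g` in `insert c V`, which are no longer needed. -/
theorem weightedSum_eliminate_le (h0 : constantCoeff g = 0)
    (hg : weightedSum (anchoredWeight τ (ℓ + 1) c) g ≤ 10⁻¹) (j : Fin n) :
    weightedSum (anchoredWeight τ (ℓ + 1) j) (eliminate ν c g) ≤
      weightedSum (anchoredWeight τ (ℓ + 1) j) g := by
  have h1 : weightedSum (anchoredWeight τ (ℓ + 1) j) (eliminate ν c g) ≤
      weightedSum (anchoredCentredWeight τ (ℓ + 1) j c) (eliminate ν c g) := by
    refine weightedSum_mono fun r V => ?_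
    by_cases hc : c ∈ V
    · rw [diffSup_coeff_eliminate h0 hc, mul_zero]
      exact zero_le
    · refine mul_le_mul_left (le_of_eq ?_) _
      unfold anchoredWeight anchoredCentredWeight
      simp [hc]
  refine h1.trans ((weightedSum_add_le _ _ _).trans ?_)
  refine (add_le_add (weightedSum_avgSeries_le _ _) (weightedSum_logCorrection_le'
    (submultiplicativeWeight_centredWeight τ ℓ c) (centredWeight_le_succ τ ℓ c)
    (leibnizWeight_anchoredCentredWeight τ ℓ j c) (anchoredCentredWeight_le_succ τ ℓ j c)
    (constantCoeff_sub_avgSeries h0) (weightedSum_sub_avgSeries_le.trans hg))).trans ?_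
  have h2 : 4⁻¹ * weightedSum (anchoredCentredWeight τ ℓ j c) (g - avgSeries ν c g) =
      weightedSum (fun r V => 4⁻¹ * anchoredCentredWeight τ ℓ j c r V)
        (g - avgSeries ν c g) := by
    simp only [weightedSum, mul_assoc, ← mul_sum, ENNReal.tsum_mul_left]
  rw [h2]
  refine weightedSum_add_sub_avgSeries_le ?_ ?_ ?_ ?_ g
  · intro r V hc
    rw [anchoredCentredWeight, if_neg (fun h => h.2.1 hc)]
  · intro r V hc
    rw [anchoredCentredWeight, if_neg (fun h => h.2.1 hc), mul_zero]
  · intro r V hc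
    unfold anchoredCentredWeight anchoredWeight
    simp [hc]
  · intro r V hc
    unfold anchoredCentredWeight anchoredWeight
    rw [card_insert_of_notMem hc]
    by_cases h : j ∈ V ∧ c ∉ V ∧ r + V.card ≤ ℓ
    · rw [if_pos h, if_pos ⟨mem_insert_of_mem h.1, by omega⟩]
      have : V.card + 1 - 1 = (V.card - 1) + 1 := by
        have := card_pos.2 ⟨j, h.1⟩
        omega
      rw [this, pow_succ]
      apply le_of_eq
      ring
    · rw [if_neg h, mul_zero]
      exact zero_le

end EliminationBounds

/-! ### Eliminating all coordinates in turn -/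

section Iteration

open PowerSeries Finset

variable {n : ℕ} {S : Fin n → Type*} [∀ i, MeasurableSpace (S i)]
  (ν : ∀ i, Measure (S i)) [∀ i, IsProbabilityMeasure (ν i)] (f : boundedMeasurable S)

/-- Averaging successively over the coordinates in a list, starting from its end. -/
def avgAll (l : List (Fin n)) : boundedMeasurable S →ₗ[ℝ] boundedMeasurable S :=
  l.foldr (fun c T => (avg ν c).comp T) LinearMap.id

/-- The formal power series `log E_l[exp (X f)]`, where `E_l` averages over the coordinates in the
list `l`. Its coefficients are the conditional cumulants of `f` divided by factorials. -/
def eliminateAll (l : List (Fin n)) : (boundedMeasurable S)⟦X⟧ :=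
  l.foldr (fun c g => eliminate ν c g) (C f * X)

theorem avgAll_nil (F : boundedMeasurable S) : avgAll ν [] F = F := rfl

theorem avgAll_cons (c : Fin n) (l : List (Fin n)) (F : boundedMeasurable S) :
    avgAll ν (c :: l) F = avg ν c (avgAll ν l F) := rfl

theorem eliminateAll_nil : eliminateAll ν f [] = C f * X := rfl

theorem eliminateAll_cons (c : Fin n) (l : List (Fin n)) :
    eliminateAll ν f (c :: l) = eliminate ν c (eliminateAll ν f l) := rfl

theorem isFormalExp_mk_pow :
    IsFormalExp (C f * X) (PowerSeries.mk fun r => (r ! : ℝ)⁻¹ • f ^ r) where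
  constantCoeff_left := by simp
  constantCoeff_right := by
    rw [← coeff_zero_eq_constantCoeff_apply, coeff_mk]
    simp
  derivative_eq := by
    ext1 r
    have : d⁄dX (boundedMeasurable S) (C f * X) = C f := by
      rw [Derivation.leibniz, derivative_X, derivative_C]
      simp
    rw [this, coeff_derivative, coeff_C_mul, coeff_mk, coeff_mk, Nat.factorial_succ]
    have h1 : ((r : boundedMeasurable S) + 1) = algebraMap ℝ _ ((r : ℝ) + 1) := by simp
    rw [h1, mul_comm _ (algebraMap ℝ _ _), ← Algebra.smul_def, smul_smul, mul_smul_comm,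
      pow_succ']
    congr 1
    push_cast
    field_simp

theorem isFormalExp_eliminateAll (l : List (Fin n)) :
    IsFormalExp (eliminateAll ν f l)
      (PowerSeries.mk fun r => (r ! : ℝ)⁻¹ • avgAll ν l (f ^ r)) := by
  induction l with
  | nil => exact isFormalExp_mk_pow f
  | cons c l ih =>
    have h := ih.eliminate (ν := ν) (c := c)
    rw [eliminateAll_cons]
    convert h using 1
    ext1 r
    rw [coeff_avgSeries, coeff_mk, coeff_mk, map_smul]
    rfl

variable {ν f} {τ : NNReal} {m : ℕ}

/-- The hypothesis on the mixed differences of `f` gives `∑_v τ α 4^{-(v-1)} ≤ 4 τ α / 3` as a bound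
for the anchored sum of the initial series; sets of more than `m` coordinates have weight zero. -/
theorem weightedSum_anchoredWeight_base {α : ℝ} (hτ : τ * α ≤ 3 / 40)
    (hsum : ∀ v ∈ Icc 1 m, ∀ j : Fin n,
      ∑ V ∈ (powersetCard v univ).filter (fun V : Finset (Fin n) => j ∈ V),
        mixedDelta V f.1 ≤ α) (j : Fin n) :
    weightedSum (anchoredWeight τ (m + 1) j) (C f * X) ≤ 10⁻¹ := by
  have hcoeff : ∀ r, r ≠ 1 → (coeff r (C f * X) : boundedMeasurable S) = 0 := by
    intro r hr
    rw [coeff_C_mul, coeff_X, if_neg hr, mul_zero]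
  have h1 : (coeff 1 (C f * X) : boundedMeasurable S) = f := by
    rw [coeff_C_mul, coeff_X, if_pos rfl, mul_one]
  have hpos : ∀ V : Finset (Fin n), 0 ≤ mixedDelta V f.1 := fun V =>
    Real.iSup_nonneg fun _ => abs_nonneg _
  have hgroup : ∀ v, ∑ V ∈ (powersetCard v univ).filter (fun V : Finset (Fin n) => j ∈ V),
      anchoredWeight τ (m + 1) j 1 V * diffSup V f.1 ≤
      ENNReal.ofReal (3 / 40) * (if v = 0 then 0 else 4⁻¹ ^ (v - 1)) := by
    intro v
    rcases Nat.eq_zero_or_pos v with rfl | hv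
    · rw [if_pos rfl, mul_zero]
      refine (sum_eq_zero fun V hV => ?_).le
      rw [mem_filter, mem_powersetCard] at hV
      have : V = ∅ := card_eq_zero.1 hV.1.2
      simp [this] at hV
    rw [if_neg hv.ne']
    rcases le_or_gt v m with hvm | hvm
    · calc _ ≤ ∑ V ∈ (powersetCard v univ).filter (fun V : Finset (Fin n) => j ∈ V),
            (τ : ℝ≥0∞) * 4⁻¹ ^ (v - 1) * ENNReal.ofReal (mixedDelta V f.1) := by
            refine sum_le_sum fun V hV => mul_le_mul' ?_ (diffSup_le_mixedDelta V f.2.2)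
            rw [mem_filter, mem_powersetCard] at hV
            rw [anchoredWeight, if_pos ⟨hV.2, by omega⟩, hV.1.2, pow_one]
        _ = (τ : ℝ≥0∞) * 4⁻¹ ^ (v - 1) * ENNReal.ofReal
            (∑ V ∈ (powersetCard v univ).filter (fun V : Finset (Fin n) => j ∈ V),
              mixedDelta V f.1) := by
            rw [← mul_sum, ENNReal.ofReal_sum_of_nonneg fun V _ => hpos V]
        _ ≤ (τ : ℝ≥0∞) * 4⁻¹ ^ (v - 1) * ENNReal.ofReal α :=
            mul_le_mul_right (ENNReal.ofReal_le_ofReal (hsum v (mem_Icc.2 ⟨hv, hvm⟩) j)) _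
        _ = ENNReal.ofReal (τ * α) * 4⁻¹ ^ (v - 1) := by
            rw [ENNReal.ofReal_mul τ.coe_nonneg, ENNReal.ofReal_coe_nnreal]
            ring
        _ ≤ _ := mul_le_mul_left (ENNReal.ofReal_le_ofReal hτ) _
    · refine (sum_eq_zero fun V hV => ?_).trans_le zero_le
      rw [mem_filter, mem_powersetCard] at hV
      rw [anchoredWeight, if_neg (by omega), zero_mul]
  calc weightedSum (anchoredWeight τ (m + 1) j) (C f * X)
      = ∑ V, anchoredWeight τ (m + 1) j 1 V * diffSup V f.1 := by
        rw [weightedSum, tsum_eq_single 1, h1]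
        intro r hr
        refine sum_eq_zero fun V _ => ?_
        rw [hcoeff r hr]
        exact (congrArg _ (diffSup_zero V)).trans (mul_zero _)
    _ = ∑ V ∈ univ.filter (fun V : Finset (Fin n) => j ∈ V),
          anchoredWeight τ (m + 1) j 1 V * diffSup V f.1 := by
        refine (sum_filter_of_ne fun V _ hV => ?_).symm
        by_contra hj
        rw [anchoredWeight, if_neg (fun h => hj h.1), zero_mul] at hV
        exact hV rfl
    _ = ∑ v ∈ range (n + 1), ∑ V ∈ (powersetCard v univ).filter
          (fun V : Finset (Fin n) => j ∈ V), anchoredWeight τ (m + 1) j 1 V * diffSup V f.1 := by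
        rw [← sum_fiberwise_of_maps_to (s := univ.filter fun V : Finset (Fin n) => j ∈ V)
          (t := range (n + 1)) (g := Finset.card)]
        · refine sum_congr rfl fun v _ => sum_congr ?_ fun _ _ => rfl
          ext V
          simp [mem_powersetCard, and_comm]
        · intro V _
          rw [mem_range, Nat.lt_succ_iff]
          simpa using card_le_univ V
    _ ≤ ∑ v ∈ range (n + 1), ENNReal.ofReal (3 / 40) * (if v = 0 then 0 else 4⁻¹ ^ (v - 1)) :=
        sum_le_sum fun v _ => hgroup v
    _ ≤ ∑' v : ℕ, ENNReal.ofReal (3 / 40) * (if v = 0 then 0 else 4⁻¹ ^ (v - 1)) :=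
        ENNReal.sum_le_tsum _
    _ = ENNReal.ofReal (3 / 40) * ∑' v : ℕ, 4⁻¹ ^ v := by
        rw [ENNReal.tsum_mul_left, tsum_eq_tsum_add_one (by simp)]
        simp
    _ ≤ ENNReal.ofReal (3 / 40) * (3 / 4)⁻¹ := by
        refine mul_le_mul_right (tsum_geometric_le ?_) _
        have : (4⁻¹ + 3 / 4 : NNReal) ≤ 1 := by
          rw [← NNReal.coe_le_coe]; push_cast; norm_num
        have h2 := ENNReal.coe_le_coe.2 this
        push_cast at h2
        simpa using h2
    _ = 10⁻¹ := by
        have e1 : (3 / 4 : ℝ≥0∞)⁻¹ = ENNReal.ofReal (4 / 3) := by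
          rw [ENNReal.inv_div (by simp) (by simp), ENNReal.ofReal_div_of_pos (by norm_num)]
          simp
        have e2 : (10⁻¹ : ℝ≥0∞) = ENNReal.ofReal (1 / 10) := by
          rw [one_div, ENNReal.ofReal_inv_of_pos (by norm_num)]
          simp
        rw [e1, e2, ← ENNReal.ofReal_mul (by norm_num)]
        norm_num

theorem weightedSum_eliminateAll_le
    (h0 : ∀ j, weightedSum (anchoredWeight τ (m + 1) j) (C f * X) ≤ 10⁻¹)
    (l : List (Fin n)) (j : Fin n) :
    weightedSum (anchoredWeight τ (m + 1) j) (eliminateAll ν f l) ≤ 10⁻¹ := by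
  induction l generalizing j with
  | nil => exact h0 j
  | cons c l ih =>
    exact (weightedSum_eliminate_le (isFormalExp_eliminateAll ν f l).constantCoeff_left
      (ih c) j).trans (ih j)

theorem abs_mul_pow_le_of_enorm {a : ℝ} {r : ℕ} {b : ℝ} (hb : 0 ≤ b)
    (h : (τ : ℝ≥0∞) ^ r * ‖a‖ₑ ≤ ENNReal.ofReal b) : |a| * (τ : ℝ) ^ r ≤ b := by
  rw [Real.enorm_eq_ofReal_abs, ← ENNReal.ofReal_coe_nnreal, ← ENNReal.ofReal_pow τ.coe_nonneg,
    ← ENNReal.ofReal_mul (by positivity), ENNReal.ofReal_le_ofReal_iff hb] at h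
  linarith

theorem ofReal_inv_eighty : ENNReal.ofReal (1 / 80) = 80⁻¹ := by
  rw [one_div, ENNReal.ofReal_inv_of_pos (by norm_num)]
  simp

/-- Each elimination changes the conditional cumulant of order `r ≥ 2` by a bounded amount. -/
theorem abs_coeff_eliminateAll_le
    (h0 : ∀ j, weightedSum (anchoredWeight τ (m + 1) j) (C f * X) ≤ 10⁻¹)
    (l : List (Fin n)) {r : ℕ} (hr : 2 ≤ r) (hrm : r ≤ m + 1) (x : ∀ i, S i) :
    |(coeff r (eliminateAll ν f l)).1 x| * (τ : ℝ) ^ r ≤ l.length * (1 / 80) := by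
  induction l generalizing x with
  | nil =>
    rw [eliminateAll_nil, coeff_C_mul, coeff_X, if_neg (by omega), mul_zero]
    simp
  | cons c l ih =>
    set g := eliminateAll ν f l with hg
    have hL := weightedSum_logCorrection_eliminate_le (ν := ν) (c := c)
      (isFormalExp_eliminateAll ν f l).constantCoeff_left (weightedSum_eliminateAll_le h0 l c)
    have h2 : |(coeff r (logCorrection ν c (g - avgSeries ν c g))).1 x| * (τ : ℝ) ^ r
        ≤ 1 / 80 := by
      refine abs_mul_pow_le_of_enorm (by norm_num) ?_
      rw [ofReal_inv_eighty]
      refine le_trans ?_ hL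
      refine le_trans ?_ (mul_diffSup_le_weightedSum _ _ r ∅)
      rw [centredWeight, if_pos (by simpa using hrm), card_empty, pow_zero, mul_one]
      exact mul_le_mul_right (enorm_le_diffSup_empty _ x) _
    have h3 : |(avg ν c (coeff r g)).1 x| * (τ : ℝ) ^ r ≤ l.length * (1 / 80) := by
      have hb : ∀ u, ‖(coeff r g).1 (Function.update x c u) * (τ : ℝ) ^ r‖ ≤
          l.length * (1 / 80) := fun u => by
        rw [Real.norm_eq_abs, abs_mul, abs_of_nonneg (pow_nonneg τ.coe_nonneg r)]
        exact ih _
      have := norm_integral_le_of_norm_le_const (μ := ν c) (Filter.Eventually.of_forall hb)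
      rw [integral_mul_const, ← avg_apply, Real.norm_eq_abs, abs_mul,
        abs_of_nonneg (pow_nonneg τ.coe_nonneg r)] at this
      simpa using this
    have h4 : (coeff r (eliminateAll ν f (c :: l))).1 x = (avg ν c (coeff r g)).1 x +
        (coeff r (logCorrection ν c (g - avgSeries ν c g))).1 x := by
      rw [eliminateAll_cons, eliminate, map_add, coeff_avgSeries]
      rfl
    rw [h4, List.length_cons]
    push_cast
    have h5 := mul_le_mul_of_nonneg_right (abs_add_le ((avg ν c (coeff r g)).1 x)
      ((coeff r (logCorrection ν c (g - avgSeries ν c g))).1 x)) (pow_nonneg τ.coe_nonneg r)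
    linarith

end Iteration

/-! ### Evaluating formal exponentials -/

section Evaluation

open PowerSeries Finset

theorem summable_norm_coeff_pow {a : ℝ⟦X⟧} (ha : Summable fun r => ‖coeff r a‖) (p : ℕ) :
    Summable (fun r => ‖coeff r (a ^ p)‖) ∧ ∑' r, coeff r (a ^ p) = (∑' r, coeff r a) ^ p ∧
      ∑' r, ‖coeff r (a ^ p)‖ ≤ (∑' r, ‖coeff r a‖) ^ p := by
  induction p with
  | zero =>
    have h1 : ∀ r, r ≠ 0 → coeff r (a ^ 0) = 0 := fun r hr => by
      rw [pow_zero, coeff_one, if_neg hr]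
    refine ⟨summable_of_ne_finset_zero (s := {0}) fun r hr => ?_, ?_, le_of_eq ?_⟩
    · rw [h1 r (by simpa using hr), norm_zero]
    · rw [tsum_eq_single 0 h1]
      simp
    · rw [tsum_eq_single 0 fun r hr => by rw [h1 r hr, norm_zero]]
      simp
  | succ p ih =>
    obtain ⟨h1, h2, h3⟩ := ih
    have hc : ∀ r, coeff r (a ^ (p + 1)) =
        ∑ q ∈ antidiagonal r, coeff q.1 (a ^ p) * coeff q.2 a := fun r => by
      rw [pow_succ, coeff_mul]
    have hs := summable_norm_sum_mul_antidiagonal_of_summable_norm h1 ha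
    have hs' := summable_norm_sum_mul_antidiagonal_of_summable_norm h1.norm ha.norm
    have ht := tsum_mul_tsum_eq_tsum_sum_antidiagonal_of_summable_norm h1 ha
    have ht' := tsum_mul_tsum_eq_tsum_sum_antidiagonal_of_summable_norm h1.norm ha.norm
    simp only [hc]
    refine ⟨hs, ?_, ?_⟩
    · rw [← ht, h2, pow_succ]
    · rw [pow_succ]
      refine le_trans ?_ (mul_le_mul_of_nonneg_right h3 (tsum_nonneg fun _ => norm_nonneg _))
      rw [ht']
      refine Summable.tsum_le_tsum (fun r => ?_) hs hs'.of_norm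
      exact (norm_sum_le _ _).trans (sum_le_sum fun q _ => norm_mul_le _ _)

/-- An absolutely convergent series may be substituted into the exponential. -/
theorem tsum_coeff_exp_subst {a : ℝ⟦X⟧} (h0 : constantCoeff a = 0)
    (ha : Summable fun r => ‖coeff r a‖) :
    ∑' r, coeff r ((exp ℝ).subst a) = Real.exp (∑' r, coeff r a) := by
  have hterm : ∀ r, coeff r ((exp ℝ).subst a) = ∑' p, (p ! : ℝ)⁻¹ * coeff r (a ^ p) := by
    intro r
    rw [coeff_subst_eq_sum _ _ h0, tsum_eq_sum (s := range (r + 1))]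
    · refine sum_congr rfl fun p _ => ?_
      rw [coeff_exp]
      simp
    · intro p hp
      have : coeff r (a ^ p) = 0 := by
        refine coeff_of_lt_order r (lt_of_lt_of_le ?_ (le_order_pow_of_constantCoeff_eq_zero p h0))
        rw [mem_range, not_lt] at hp
        exact_mod_cast hp
      rw [this, mul_zero]
  have hsum : Summable (Function.uncurry fun p r : ℕ => (p ! : ℝ)⁻¹ * coeff r (a ^ p)) := by
    refine Summable.of_norm ((summable_prod_of_nonneg fun _ => norm_nonneg _).2 ⟨fun p => ?_, ?_⟩)
    · simp only [Function.uncurry, norm_mul]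
      exact (summable_norm_coeff_pow ha p).1.mul_left _
    · refine Summable.of_nonneg_of_le (fun p => tsum_nonneg fun _ => norm_nonneg _) (fun p => ?_)
        (Real.summable_pow_div_factorial (∑' r, ‖coeff r a‖))
      simp only [Function.uncurry, norm_mul]
      rw [tsum_mul_left, norm_inv, Real.norm_natCast, div_eq_inv_mul]
      exact mul_le_mul_of_nonneg_left (summable_norm_coeff_pow ha p).2.2 (by positivity)
  simp only [hterm]
  rw [hsum.tsum_comm, Real.exp_eq_exp_ℝ, NormedSpace.exp_eq_tsum_div]
  refine tsum_congr fun p => ?_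
  rw [tsum_mul_left, (summable_norm_coeff_pow ha p).2.1, div_eq_inv_mul]

end Evaluation

/-! ### Truncation error in one elimination step -/

section Truncation

open PowerSeries Finset

variable {n : ℕ} {S : Fin n → Type*} [∀ i, MeasurableSpace (S i)]

/-- The weight `τ^r` on the empty set: it measures the suprema of the coefficients. -/
def supWeight (τ : NNReal) (r : ℕ) (V : Finset (Fin n)) : ℝ≥0∞ :=
  if V = ∅ then (τ : ℝ≥0∞) ^ r else 0

theorem submultiplicativeWeight_supWeight (τ : NNReal) :
    SubmultiplicativeWeight (n := n) (supWeight τ) (supWeight τ) := by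
  intro a b U V _ _ _
  unfold supWeight
  by_cases h : U ∪ V = ∅
  · rw [if_pos h]
    rw [union_eq_empty] at h
    rw [if_pos h.1, if_pos h.2, pow_add]
  · rw [if_neg h]
    exact zero_le

theorem weightedSum_supWeight (τ : NNReal) (F : (boundedMeasurable S)⟦X⟧) :
    weightedSum (supWeight τ) F = ∑' r, (τ : ℝ≥0∞) ^ r * diffSup ∅ (coeff r F).1 := by
  refine tsum_congr fun r => ?_
  rw [sum_eq_single ∅]
  · rw [supWeight, if_pos rfl]
  · intro V _ hV
    rw [supWeight, if_neg hV, zero_mul]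
  · simp

/-- If `τ ≥ 1`, a finite supremum-weighted sum bounds the coefficients summably, uniformly in the
evaluation point. -/
theorem exists_summable_bound {τ : NNReal} (hτ : 1 ≤ τ) {F : (boundedMeasurable S)⟦X⟧}
    (hF : weightedSum (supWeight τ) F ≠ ⊤) :
    ∃ b : ℕ → ℝ, Summable b ∧ ∀ r x, ‖(coeff r F).1 x‖ ≤ b r := by
  rw [weightedSum_supWeight] at hF
  have hne : ∀ r, (τ : ℝ≥0∞) ^ r * diffSup ∅ (coeff r F).1 ≠ ⊤ := ENNReal.ne_top_of_tsum_ne_top hF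
  refine ⟨fun r => ((τ : ℝ≥0∞) ^ r * diffSup ∅ (coeff r F).1).toReal,
    ENNReal.summable_toReal hF, fun r x => ?_⟩
  rw [← toReal_enorm]
  refine ENNReal.toReal_mono (hne r) ((enorm_le_diffSup_empty _ x).trans ?_)
  exact le_mul_of_one_le_left' (one_le_pow_of_one_le' (by exact_mod_cast hτ) r)

variable (ν : ∀ i, Measure (S i)) [∀ i, IsProbabilityMeasure (ν i)] (c : Fin n)

/-- Averaging commutes with the summation of an absolutely convergent power series. -/
theorem tsum_coeff_avgSeries {F : (boundedMeasurable S)⟦X⟧} {b : ℕ → ℝ} (hb : Summable b)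
    (hF : ∀ r x, ‖(coeff r F).1 x‖ ≤ b r) (x : ∀ i, S i) :
    ∑' r, (coeff r (avgSeries ν c F)).1 x =
      ∫ u, ∑' r, (coeff r F).1 (Function.update x c u) ∂ν c := by
  have h := hasSum_integral_of_summable_integral_norm (μ := ν c)
    (F := fun r u => (coeff r F).1 (Function.update x c u))
    (fun r => integrable_update ν c (coeff r F) x) ?_
  · rw [← h.tsum_eq]
    exact tsum_congr fun r => by rw [coeff_avgSeries, avg_apply]
  · refine Summable.of_nonneg_of_le (fun r => integral_nonneg fun u => norm_nonneg _)
      (fun r => ?_) hb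
    refine (integral_mono (integrable_update ν c (coeff r F) x).norm (integrable_const (b r))
      fun u => hF r _).trans_eq ?_
    simp

/-- The exponential of a bounded measurable function. -/
def expFun (F : boundedMeasurable S) : boundedMeasurable S :=
  ⟨fun x => Real.exp (F.1 x), Real.measurable_exp.comp F.2.1, by
    obtain ⟨C, hC⟩ := F.2.2
    exact ⟨Real.exp C, fun x => by
      rw [Real.abs_exp]
      exact Real.exp_le_exp.2 ((le_abs_self _).trans (hC x))⟩⟩

theorem expFun_apply (F : boundedMeasurable S) (x : ∀ i, S i) :
    (expFun F).1 x = Real.exp (F.1 x) := rfl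

/-- The sum of the coefficients of order at most `m`. -/
def partialSum (m : ℕ) (g : (boundedMeasurable S)⟦X⟧) : boundedMeasurable S :=
  ∑ r ∈ range (m + 1), coeff r g

theorem partialSum_apply (m : ℕ) (g : (boundedMeasurable S)⟦X⟧) (x : ∀ i, S i) :
    (partialSum m g).1 x = ∑ r ∈ range (m + 1), (coeff r g).1 x := by
  rw [← evalAt_apply, partialSum, map_sum]
  rfl

variable {ν c} {τ : NNReal} {m : ℕ} {g : (boundedMeasurable S)⟦X⟧}

/-- Coefficients up to order `m` of a substitution depend only on coefficients up to order `m`. -/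
theorem coeff_subst_congr {A : Type*} [CommRing A] {f a b : A⟦X⟧} (ha : constantCoeff a = 0)
    (hb : constantCoeff b = 0) (h : ∀ r ≤ m, coeff r a = coeff r b) :
    ∀ r ≤ m, coeff r (f.subst a) = coeff r (f.subst b) := by
  intro r hr
  rw [coeff_subst_eq_sum _ _ ha, coeff_subst_eq_sum _ _ hb]
  have hpow : ∀ p, ∀ s ≤ m, coeff s (a ^ p) = coeff s (b ^ p) := by
    intro p
    induction p with
    | zero => simp
    | succ p ih =>
      intro s hs
      rw [pow_succ, pow_succ, coeff_mul, coeff_mul]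
      refine sum_congr rfl fun q hq => ?_
      rw [HasAntidiagonal.mem_antidiagonal] at hq
      rw [ih _ (by omega), h _ (by omega)]
  exact sum_congr rfl fun p _ => by rw [hpow p r hr]

theorem coeff_logCorrection_congr {a b : (boundedMeasurable S)⟦X⟧} (ha : constantCoeff a = 0)
    (hb : constantCoeff b = 0) (h : ∀ r ≤ m, coeff r a = coeff r b) :
    ∀ r ≤ m, coeff r (logCorrection ν c a) = coeff r (logCorrection ν c b) := by
  refine coeff_subst_congr (constantCoeff_expRemainder ha) (constantCoeff_expRemainder hb) ?_
  intro r hr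
  rw [expRemainder, expRemainder, coeff_avgSeries, coeff_avgSeries,
    coeff_subst_congr ha hb h r hr]

/-- The series `log E_c[exp g]`, truncated at order `m` before and after averaging over `c`,
evaluates to the logarithm of the average, up to an error of order `τ^{-(m+1)}`: the coefficients
of the logarithm decay geometrically, since those of the truncated `g` are under control. -/
theorem exists_avg_expFun_partialSum (hτ : 1 ≤ τ) (h0 : constantCoeff g = 0)
    (hg : weightedSum (anchoredWeight τ (m + 1) c) g ≤ 10⁻¹) (x : ∀ i, S i) :
    ∃ e : ℝ, |e| * (τ : ℝ) ^ (m + 1) ≤ 1 / 80 ∧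
      (avg ν c (expFun (partialSum m g))).1 x =
        Real.exp ((partialSum m (eliminate ν c g)).1 x + e) := by
  -- The centred series is truncated, since only its coefficients up to order `m` are controlled.
  set h := g - avgSeries ν c g with hh
  have hh0 : constantCoeff h = 0 := constantCoeff_sub_avgSeries h0
  set t : (boundedMeasurable S)⟦X⟧ :=
    PowerSeries.mk fun r => if r ≤ m then coeff r h else 0 with ht
  have htc : ∀ r, coeff r t = if r ≤ m then coeff r h else 0 := fun r => by rw [ht, coeff_mk]
  have ht0 : constantCoeff t = 0 := by
    rw [← coeff_zero_eq_constantCoeff_apply, htc, if_pos (Nat.zero_le m),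
      coeff_zero_eq_constantCoeff_apply, hh0]
  have hta : avgSeries ν c t = 0 := by
    ext1 r
    rw [coeff_avgSeries, htc, map_zero]
    split_ifs
    · rw [← coeff_avgSeries, hh, avgSeries_sub_self, map_zero]
    · exact map_zero _
  have htw : weightedSum (supWeight τ) t ≤ 10⁻¹ := by
    refine le_trans ?_ ((weightedSum_sub_avgSeries_le (ν := ν)).trans hg)
    refine weightedSum_mono fun r V => ?_
    by_cases hV : V = ∅
    · rw [htc]
      split_ifs with hr
      · refine mul_le_mul_left (le_of_eq ?_) _
        rw [supWeight, if_pos hV, centredWeight, hV, if_pos (by simpa using hr)]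
        simp
      · exact ((congrArg _ (diffSup_zero V)).trans (mul_zero _)).trans_le zero_le
    · rw [supWeight, if_neg hV, zero_mul]
      exact zero_le
  have hsub := submultiplicativeWeight_supWeight (n := n) τ
  set L := logCorrection ν c t with hL
  have hLw : weightedSum (supWeight τ) L ≤ 80⁻¹ :=
    weightedSum_logCorrection_le hsub (fun _ _ => le_rfl) ht0 htw
  have hLexp : IsFormalExp L (avgSeries ν c ((exp (boundedMeasurable S)).subst t)) :=
    isFormalExp_logCorrection ht0 hta
  have hL0 := hLexp.constantCoeff_left
  have hLcoeff : ∀ r ≤ m, coeff r L = coeff r (logCorrection ν c h) :=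
    coeff_logCorrection_congr ht0 hh0 fun r hr => by rw [htc, if_pos hr]
  -- Evaluation at real points of the exponentials of `t` and of `L`.
  have heval : ∀ {F : (boundedMeasurable S)⟦X⟧}, constantCoeff F = 0 →
      weightedSum (supWeight τ) F ≠ ⊤ → ∀ y,
      ∑' r, (coeff r ((exp (boundedMeasurable S)).subst F) : boundedMeasurable S).1 y =
        Real.exp (∑' r, (coeff r F).1 y) := by
    intro F hF0 hF y
    obtain ⟨b, hb, hbF⟩ := exists_summable_bound hτ hF
    have := tsum_coeff_exp_subst (a := PowerSeries.map (evalAt y) F)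
      (by rw [← coeff_zero_eq_constantCoeff_apply, coeff_map, coeff_zero_eq_constantCoeff_apply,
            hF0, map_zero])
      (by
        simp only [coeff_map_evalAt]
        exact Summable.of_nonneg_of_le (fun _ => norm_nonneg _) (fun r => hbF r y) hb)
    rw [← map_exp (evalAt y), ← map_evalAt_subst _ _ _ hF0] at this
    simpa only [coeff_map_evalAt] using this
  have htsum : ∀ y, ∑' r, (coeff r t).1 y = (partialSum m h).1 y := by
    intro y
    rw [partialSum_apply, tsum_eq_sum (s := range (m + 1))]
    · refine sum_congr rfl fun r hr => ?_
      rw [htc, if_pos (Nat.lt_succ_iff.1 (mem_range.1 hr))]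
    · intro r hr
      rw [htc, if_neg (by simpa [Nat.lt_succ_iff] using hr)]
      rfl
  have hexpw : weightedSum (supWeight τ) ((exp (boundedMeasurable S)).subst t) ≠ ⊤ := by
    have hs := HasSubst.of_constantCoeff_zero' ht0
    have h1 : ((exp (boundedMeasurable S)).subst t : (boundedMeasurable S)⟦X⟧) =
        1 + t + (exp (boundedMeasurable S) - 1 - X).subst t := by
      rw [← coe_substAlgHom hs, map_sub, map_sub, map_one, coe_substAlgHom, subst_X hs]
      ring
    have h2 : weightedSum (supWeight τ) (1 : (boundedMeasurable S)⟦X⟧) ≤ 1 := by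
      rw [weightedSum_supWeight, tsum_eq_single 0]
      · rw [pow_zero, one_mul, coeff_one, if_pos rfl, diffSup_le_iff]
        intro y z
        rw [mixedDiff_empty]
        change ‖(1 : ℝ)‖ₑ ≤ 1
        simp
      · intro r hr
        rw [coeff_one, if_neg hr]
        exact (congrArg _ (diffSup_zero ∅)).trans (mul_zero _)
    rw [h1]
    refine ne_top_of_le_ne_top ?_ ((weightedSum_add_le _ _ _).trans (add_le_add
      ((weightedSum_add_le _ _ _).trans (add_le_add h2 htw))
      (weightedSum_expRemainder_le hsub hsub ht0 htw)))
    simp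
  -- The average of the exponential of the truncated centred series.
  have hkey : ∫ u, Real.exp ((partialSum m h).1 (Function.update x c u)) ∂ν c =
      Real.exp (∑' r, (coeff r L).1 x) := by
    obtain ⟨b, hb, hbF⟩ := exists_summable_bound hτ hexpw
    rw [← heval hL0 (ne_top_of_le_ne_top (by simp) hLw) x,
      (isFormalExp_exp hL0).right_unique hLexp, tsum_coeff_avgSeries ν c hb hbF x]
    refine integral_congr_ae (Filter.Eventually.of_forall fun u => ?_)
    simp only
    rw [heval ht0 (ne_top_of_le_ne_top (by simp) htw), htsum]
  obtain ⟨b, hb, hbL⟩ := exists_summable_bound hτ (ne_top_of_le_ne_top (by simp) hLw)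
  have hLsum : Summable fun r => (coeff r L).1 x :=
    Summable.of_norm (Summable.of_nonneg_of_le (fun _ => norm_nonneg _) (fun r => hbL r x) hb)
  refine ⟨∑' r, (coeff (r + (m + 1)) L).1 x, ?_, ?_⟩
  · refine abs_mul_pow_le_of_enorm (by norm_num) ?_
    rw [ofReal_inv_eighty]
    refine le_trans ?_ hLw
    rw [weightedSum_supWeight]
    calc (τ : ℝ≥0∞) ^ (m + 1) * ‖∑' r, (coeff (r + (m + 1)) L).1 x‖ₑ
        ≤ (τ : ℝ≥0∞) ^ (m + 1) * ∑' r, ‖(coeff (r + (m + 1)) L).1 x‖ₑ :=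
          mul_le_mul_right (enorm_tsum_le_tsum_enorm) _
      _ = ∑' r, (τ : ℝ≥0∞) ^ (m + 1) * ‖(coeff (r + (m + 1)) L).1 x‖ₑ :=
          ENNReal.tsum_mul_left.symm
      _ ≤ ∑' r, (τ : ℝ≥0∞) ^ (r + (m + 1)) * diffSup ∅ (coeff (r + (m + 1)) L).1 := by
          refine ENNReal.tsum_le_tsum fun r => mul_le_mul' ?_ (enorm_le_diffSup_empty _ x)
          exact pow_le_pow_right₀ (by exact_mod_cast hτ) (by omega)
      _ ≤ ∑' r, (τ : ℝ≥0∞) ^ r * diffSup ∅ (coeff r L).1 :=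
          ENNReal.tsum_comp_le_tsum_of_injective (add_left_injective (m + 1))
            (fun r => (τ : ℝ≥0∞) ^ r * diffSup ∅ (coeff r L).1)
  · have hgsplit : ∀ u, (partialSum m g).1 (Function.update x c u) =
        (partialSum m (avgSeries ν c g)).1 x + (partialSum m h).1 (Function.update x c u) := by
      intro u
      simp only [partialSum_apply, ← sum_add_distrib]
      refine sum_congr rfl fun r _ => ?_
      have : (coeff r h).1 (Function.update x c u) = (coeff r g).1 (Function.update x c u) -
          (coeff r (avgSeries ν c g)).1 (Function.update x c u) := by
        rw [hh, map_sub]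
        rfl
      rw [this, coeff_avgSeries, avg_update]
      ring
    have h1 : (avg ν c (expFun (partialSum m g))).1 x =
        Real.exp ((partialSum m (avgSeries ν c g)).1 x) * Real.exp (∑' r, (coeff r L).1 x) := by
      rw [avg_apply, ← hkey, ← integral_const_mul]
      refine integral_congr_ae (Filter.Eventually.of_forall fun u => ?_)
      simp only [expFun_apply, hgsplit, Real.exp_add]
    have h2 : (partialSum m (eliminate ν c g)).1 x =
        (partialSum m (avgSeries ν c g)).1 x + ∑ r ∈ range (m + 1), (coeff r L).1 x := by
      simp only [partialSum_apply, ← sum_add_distrib]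
      refine sum_congr rfl fun r hr => ?_
      rw [eliminate, map_add, hLcoeff r (Nat.lt_succ_iff.1 (mem_range.1 hr))]
      rfl
    rw [h1, h2, ← Real.exp_add, add_assoc, hLsum.sum_add_tsum_nat_add]

/-- Iterating over the coordinates in a list, the truncation errors add up. -/
theorem exists_avgAll_expFun {f : boundedMeasurable S} (hτ : 1 ≤ τ) (hm : 0 < m)
    (h0 : ∀ j, weightedSum (anchoredWeight τ (m + 1) j) (C f * X) ≤ 10⁻¹)
    (l : List (Fin n)) (x : ∀ i, S i) :
    ∃ e : ℝ, |e| * (τ : ℝ) ^ (m + 1) ≤ l.length * (1 / 80) ∧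
      (avgAll ν l (expFun f)).1 x = Real.exp ((partialSum m (eliminateAll ν f l)).1 x + e) := by
  have hpos : 0 < (τ : ℝ) ^ (m + 1) := pow_pos (by exact_mod_cast lt_of_lt_of_le one_pos hτ) _
  induction l generalizing x with
  | nil =>
    refine ⟨0, by simp, ?_⟩
    rw [avgAll_nil, expFun_apply, partialSum_apply, add_zero, sum_eq_single 1]
    · rw [eliminateAll_nil, coeff_C_mul, coeff_X, if_pos rfl, mul_one]
    · intro r _ hr
      rw [eliminateAll_nil, coeff_C_mul, coeff_X, if_neg hr, mul_zero]
      rfl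
    · intro h
      exact absurd (mem_range.2 (by omega)) h
  | cons c l ih =>
    set g := eliminateAll ν f l
    set B : ℝ := l.length * (1 / 80) / (τ : ℝ) ^ (m + 1) with hB
    obtain ⟨e, he, hee⟩ := exists_avg_expFun_partialSum (ν := ν) (c := c) hτ
      (isFormalExp_eliminateAll ν f l).constantCoeff_left (weightedSum_eliminateAll_le h0 l c) x
    set Tx := (partialSum m (eliminate ν c g)).1 x with hTx
    have hbd : ∀ y, Real.exp (-B) * (expFun (partialSum m g)).1 y ≤ (avgAll ν l (expFun f)).1 y ∧
        (avgAll ν l (expFun f)).1 y ≤ Real.exp B * (expFun (partialSum m g)).1 y := by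
      intro y
      obtain ⟨e', he', hee'⟩ := ih y
      have habs : |e'| ≤ B := by rwa [hB, le_div_iff₀ hpos]
      rw [hee', expFun_apply, ← Real.exp_add, ← Real.exp_add, Real.exp_le_exp, Real.exp_le_exp]
      constructor <;> linarith [(abs_le.1 habs).1, (abs_le.1 habs).2]
    have hlow := avg_mono ν c (F := Real.exp (-B) • expFun (partialSum m g))
      (G := avgAll ν l (expFun f)) (fun y => (hbd y).1) x
    have hup := avg_mono ν c (F := avgAll ν l (expFun f))
      (G := Real.exp B • expFun (partialSum m g)) (fun y => (hbd y).2) x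
    rw [map_smul] at hlow hup
    have hlow' : Real.exp (Tx + (e - B)) ≤ (avgAll ν (c :: l) (expFun f)).1 x := by
      refine le_trans (le_of_eq ?_) hlow
      change _ = Real.exp (-B) * (avg ν c (expFun (partialSum m g))).1 x
      rw [hee, ← Real.exp_add]
      congr 1
      ring
    have hup' : (avgAll ν (c :: l) (expFun f)).1 x ≤ Real.exp (Tx + (e + B)) := by
      refine le_trans hup (le_of_eq ?_)
      change Real.exp B * (avg ν c (expFun (partialSum m g))).1 x = _
      rw [hee, ← Real.exp_add]
      congr 1
      ring
    have hpos' : 0 < (avgAll ν (c :: l) (expFun f)).1 x := (Real.exp_pos _).trans_le hlow'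
    rw [← Real.le_log_iff_exp_le hpos'] at hlow'
    rw [← Real.log_le_iff_le_exp hpos'] at hup'
    refine ⟨Real.log ((avgAll ν (c :: l) (expFun f)).1 x) - Tx, ?_, ?_⟩
    · have h1 : |Real.log ((avgAll ν (c :: l) (expFun f)).1 x) - Tx| ≤ |e| + B := by
        rw [abs_le]
        constructor <;> linarith [neg_abs_le e, le_abs_self e]
      refine (mul_le_mul_of_nonneg_right h1 hpos.le).trans ?_
      rw [add_mul, hB, div_mul_cancel₀ _ hpos.ne', List.length_cons]
      push_cast
      linarith
    · rw [eliminateAll_cons, ← hTx, add_sub_cancel, Real.exp_log hpos']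

end Truncation

/-! ### Cumulants as coefficients of a formal logarithm -/

section Partitions

open PowerSeries Finset

/-- The sum over all partitions of `s` into `p` blocks of the product of `M |B|` over the
blocks `B`. -/
def blockSum {α : Type*} [DecidableEq α] (M : ℕ → ℝ) (p : ℕ) (s : Finset α) : ℝ :=
  ∑ P : Finpartition s with P.parts.card = p, ∏ B ∈ P.parts, M B.card

/-- Removing the block containing a given element. -/
theorem blockSum_insert {α : Type*} [DecidableEq α] (M : ℕ → ℝ) (p : ℕ) {s : Finset α} {a : α}
    (ha : a ∉ s) : blockSum M (p + 1) (insert a s) =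
      ∑ U ∈ s.powerset, M (U.card + 1) * blockSum M p (s \ U) := by
  have hmaps : ∀ P ∈ (univ : Finset (Finpartition (insert a s))).filter
      (fun P => P.parts.card = p + 1), (P.part a).erase a ∈ s.powerset := by
    intro P _
    rw [mem_powerset]
    intro x hx
    rw [mem_erase] at hx
    exact (mem_insert.1 (P.part_subset a hx.2)).resolve_left hx.1
  rw [blockSum, ← sum_fiberwise_of_maps_to hmaps]
  refine sum_congr rfl fun U hU => ?_
  rw [mem_powerset] at hU
  have haU : a ∉ U := fun h => ha (hU h)
  have hdisj : Disjoint (s \ U) (insert a U) := by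
    rw [disjoint_insert_right]
    exact ⟨fun h => ha (mem_sdiff.1 h).1, sdiff_disjoint⟩
  have hsup : s \ U ⊔ insert a U = insert a s := by
    rw [sup_eq_union, union_insert, sdiff_union_of_subset hU]
  have hnotMem : ∀ Q : Finpartition (s \ U), insert a U ∉ Q.parts := fun Q hQ =>
    ha (mem_sdiff.1 (Q.subset hQ (mem_insert_self a U))).1
  rw [blockSum, mul_sum]
  symm
  refine sum_bij (fun Q _ => Q.extend (insert_ne_empty a U) hdisj hsup) ?_ ?_ ?_ ?_
  · intro Q hQ
    rw [mem_filter] at hQ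
    have hpart : (Q.extend (insert_ne_empty a U) hdisj hsup).part a = insert a U :=
      Finpartition.part_eq_of_mem _ (mem_insert_self _ _) (mem_insert_self _ _)
    rw [mem_filter, mem_filter, hpart, erase_insert haU]
    refine ⟨⟨mem_univ _, ?_⟩, rfl⟩
    change (insert (insert a U) Q.parts).card = p + 1
    rw [card_insert_of_notMem (hnotMem Q), hQ.2]
  · intro Q _ Q' _ h
    have h' : insert (insert a U) Q.parts = insert (insert a U) Q'.parts :=
      congrArg Finpartition.parts h
    refine Finpartition.ext ?_
    rw [← erase_insert (hnotMem Q), h', erase_insert (hnotMem Q')]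
  · intro P hP
    rw [mem_filter, mem_filter] at hP
    have hpa : P.part a ∈ P.parts := P.part_mem.2 (mem_insert_self a s)
    have haP : a ∈ P.part a := P.mem_part_self.2 (mem_insert_self a s)
    have hpart : P.part a = insert a U := by rw [← hP.2, insert_erase haP]
    have hmem : insert a U ∈ P.parts := hpart ▸ hpa
    have hsupQ : (P.parts.erase (insert a U)).sup id = s \ U := by
      ext x
      simp only [mem_sup, mem_erase, id, mem_sdiff]
      constructor
      · rintro ⟨B, ⟨hne, hB⟩, hx⟩
        have hx' : x ∉ insert a U := fun h => hne (P.eq_of_mem_parts hB hmem hx h)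
        rw [mem_insert, not_or] at hx'
        exact ⟨(mem_insert.1 (P.subset hB hx)).resolve_left hx'.1, hx'.2⟩
      · rintro ⟨hxs, hxU⟩
        obtain ⟨B, hB, hx⟩ := P.exists_mem (mem_insert_of_mem (a := x) hxs)
        refine ⟨B, ⟨?_, hB⟩, hx⟩
        rintro rfl
        rcases mem_insert.1 hx with rfl | h
        · exact ha hxs
        · exact hxU h
    refine ⟨P.ofSubset (erase_subset _ _) hsupQ, ?_, ?_⟩
    · rw [mem_filter]
      refine ⟨mem_univ _, ?_⟩
      change (P.parts.erase (insert a U)).card = p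
      rw [card_erase_of_mem hmem, hP.1.2, Nat.add_sub_cancel]
    · refine Finpartition.ext ?_
      change insert (insert a U) (P.parts.erase (insert a U)) = P.parts
      exact insert_erase hmem
  · intro Q _
    change _ = ∏ B ∈ insert (insert a U) Q.parts, M B.card
    rw [prod_insert (hnotMem Q), card_insert_of_notMem haU]

/-- The exponential generating function of a sequence of moments, without its constant term. -/
def momentSeries (M : ℕ → ℝ) : ℝ⟦X⟧ :=
  PowerSeries.mk fun r => if r = 0 then 0 else M r / (r ! : ℝ)

theorem constantCoeff_momentSeries (M : ℕ → ℝ) : constantCoeff (momentSeries M) = 0 := by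
  rw [← coeff_zero_eq_constantCoeff_apply, momentSeries, coeff_mk, if_pos rfl]

/-- The exponential formula for partitions into a fixed number of blocks. -/
theorem blockSum_eq {α : Type*} [DecidableEq α] (M : ℕ → ℝ) (p : ℕ) (s : Finset α) :
    blockSum M p s = (s.card ! : ℝ) * coeff s.card (momentSeries M ^ p) / (p ! : ℝ) := by
  induction p generalizing s with
  | zero =>
    have hiff : ∀ P : Finpartition s, P.parts.card = 0 ↔ s = ∅ := fun P => by
      rw [card_eq_zero, P.parts_eq_empty_iff, bot_eq_empty]
    rcases eq_or_ne s ∅ with rfl | hs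
    · rw [blockSum, filter_true_of_mem fun P _ => (hiff P).2 rfl]
      have : Unique (Finpartition (∅ : Finset α)) :=
        inferInstanceAs (Unique (Finpartition (⊥ : Finset α)))
      rw [Fintype.sum_unique, (this.default.parts_eq_empty_iff).2 rfl]
      simp
    · rw [blockSum, filter_false_of_mem fun P _ h => hs ((hiff P).1 h), sum_empty, pow_zero,
        coeff_one, if_neg (card_ne_zero.2 (nonempty_iff_ne_empty.2 hs))]
      simp
  | succ p ih =>
    rcases s.eq_empty_or_nonempty with rfl | ⟨a, ha⟩
    · have h0 : ∀ P : Finpartition (∅ : Finset α), P.parts.card ≠ p + 1 := fun P => by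
        rw [(P.parts_eq_empty_iff).2 rfl]
        simp
      rw [blockSum, filter_false_of_mem fun P _ => h0 P, sum_empty, card_empty,
        coeff_zero_eq_constantCoeff_apply, map_pow, constantCoeff_momentSeries]
      simp
    · obtain ⟨t, hat, rfl⟩ : ∃ t, a ∉ t ∧ insert a t = s :=
        ⟨s.erase a, notMem_erase a s, insert_erase ha⟩
      rw [blockSum_insert M p hat, card_insert_of_notMem hat]
      have h1 : ∀ U ∈ t.powerset, M (U.card + 1) * blockSum M p (t \ U) =
          M (U.card + 1) * (((t.card - U.card)! : ℝ) *
            coeff (t.card - U.card) (momentSeries M ^ p) / (p ! : ℝ)) := fun U hU => by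
        rw [ih, card_sdiff_of_subset (mem_powerset.1 hU)]
      rw [sum_congr rfl h1, sum_powerset_apply_card (fun i => M (i + 1) *
        (((t.card - i)! : ℝ) * coeff (t.card - i) (momentSeries M ^ p) / (p ! : ℝ)))]
      have hd : coeff (t.card + 1) (momentSeries M ^ (p + 1)) * (t.card + 1) =
          (p + 1) * ∑ i ∈ range (t.card + 1), M (i + 1) / (i ! : ℝ) *
            coeff (t.card - i) (momentSeries M ^ p) := by
        rw [← coeff_derivative, derivative_pow, Nat.add_sub_cancel, mul_assoc,
          mul_comm (momentSeries M ^ p)]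
        have : ((p + 1 : ℕ) : ℝ⟦X⟧) = C ((p : ℝ) + 1) := by simp
        rw [this, coeff_C_mul, coeff_mul, Nat.sum_antidiagonal_eq_sum_range_succ
          (fun i j => coeff i (d⁄dX ℝ (momentSeries M)) * coeff j (momentSeries M ^ p))]
        congr 1
        refine sum_congr rfl fun i _ => ?_
        rw [coeff_derivative, momentSeries, coeff_mk, if_neg (by omega), Nat.factorial_succ]
        push_cast
        field_simp
      have hp : (p ! : ℝ) ≠ 0 := by positivity
      have hp1 : ((p : ℝ) + 1) ≠ 0 := by positivity
      have hgoal : ((t.card + 1)! : ℝ) * coeff (t.card + 1) (momentSeries M ^ (p + 1)) /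
          ((p + 1)! : ℝ) = (t.card ! : ℝ) / (p ! : ℝ) * ∑ i ∈ range (t.card + 1),
            M (i + 1) / (i ! : ℝ) * coeff (t.card - i) (momentSeries M ^ p) := by
        rw [Nat.factorial_succ, Nat.factorial_succ, div_eq_iff (by positivity)]
        push_cast
        have := congrArg (fun z => (t.card ! : ℝ) * z) hd
        rw [mul_comm ((t.card : ℝ) + 1), mul_assoc, mul_comm ((t.card : ℝ) + 1), this]
        field_simp
      rw [hgoal, mul_sum]
      refine sum_congr rfl fun i hi => ?_
      rw [nsmul_eq_mul, Nat.cast_choose ℝ (Nat.lt_succ_iff.1 (mem_range.1 hi))]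
      have hi1 : (i ! : ℝ) ≠ 0 := by positivity
      have hi2 : ((t.card - i)! : ℝ) ≠ 0 := by positivity
      field_simp

/-- The moment-cumulant relation: `κ_r / r!` is a coefficient of the logarithm of the exponential
generating function of the moments. -/
theorem coeff_log_momentSeries {Ω : Type*} [MeasurableSpace Ω] (μ : Measure Ω) (Z : Ω → ℝ)
    {r : ℕ} (hr : 0 < r) :
    coeff r ((log ℝ).subst (momentSeries fun k => ∫ ω, Z ω ^ k ∂μ) : ℝ⟦X⟧) =
      cumulant μ r Z / (r ! : ℝ) := by
  set M : ℕ → ℝ := fun k => ∫ ω, Z ω ^ k ∂μ with hM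
  have h1 : cumulant μ r Z = ∑ p ∈ range (r + 1),
      (-1 : ℝ) ^ (p - 1) * ((p - 1)! : ℝ) * blockSum M p (univ : Finset (Fin r)) := by
    rw [cumulant, jointCumulant, ← sum_fiberwise_of_maps_to (t := range (r + 1))
      (g := fun P : Finpartition (univ : Finset (Fin r)) => P.parts.card)]
    · refine sum_congr rfl fun p _ => ?_
      rw [blockSum, mul_sum]
      refine sum_congr rfl fun P hP => ?_
      rw [(mem_filter.1 hP).2]
      simp only [prod_const, hM]
    · intro P _
      rw [mem_range, Nat.lt_succ_iff]
      simpa using P.card_parts_le_card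
  rw [coeff_subst_eq_sum _ _ (constantCoeff_momentSeries M), h1, sum_div]
  refine sum_congr rfl fun p _ => ?_
  rw [blockSum_eq, card_univ, Fintype.card_fin, coeff_log]
  rcases p with _ | p
  · rw [pow_zero, coeff_one, if_neg hr.ne']
    simp
  · rw [if_neg (by omega), Nat.add_sub_cancel, Nat.factorial_succ]
    have hr' : (r ! : ℝ) ≠ 0 := by positivity
    have hp : (p ! : ℝ) ≠ 0 := by positivity
    have hp1 : ((p : ℝ) + 1) ≠ 0 := by positivity
    push_cast
    field_simp
    ring

end Partitions

/-! ### Averaging over all coordinates -/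

section FullAverage

open Finset

variable {n : ℕ} {S : Fin n → Type*}

theorem apply_eq_of_update {F : (∀ i, S i) → ℝ}
    (hF : ∀ j x u, F (Function.update x j u) = F x) (x y : ∀ i, S i) : F y = F x := by
  have h : ∀ s : Finset (Fin n), F (s.piecewise y x) = F x := by
    intro s
    induction s using Finset.induction_on with
    | empty => rw [piecewise_empty]
    | insert j s _ ih => rw [piecewise_insert, hF, ih]
  simpa using h univ

variable [∀ i, MeasurableSpace (S i)] (ν : ∀ i, Measure (S i)) [∀ i, IsProbabilityMeasure (ν i)]

theorem avgAll_update (F : boundedMeasurable S) {l : List (Fin n)} {j : Fin n} (hj : j ∈ l)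
    (x : ∀ i, S i) (u : S j) :
    (avgAll ν l F).1 (Function.update x j u) = (avgAll ν l F).1 x := by
  induction l generalizing x with
  | nil => simp at hj
  | cons c l ih =>
    rw [avgAll_cons]
    rcases eq_or_ne j c with rfl | hjc
    · exact avg_update ν j _ x u
    · have hjl : j ∈ l := (List.mem_cons.1 hj).resolve_left hjc
      rw [avg_apply, avg_apply]
      refine integral_congr_ae (Filter.Eventually.of_forall fun v => ?_)
      simp only
      rw [Function.update_comm hjc, ih hjl]

/-- Resampling one coordinate preserves a product of probability measures. -/
theorem map_update_prod_pi (c : Fin n) :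
    ((Measure.pi ν).prod (ν c)).map (fun p : (∀ i, S i) × S c => Function.update p.1 c p.2) =
      Measure.pi ν := by
  symm
  refine Measure.pi_eq fun s hs => ?_
  rw [Measure.map_apply measurable_update' (MeasurableSet.univ_pi hs)]
  have : (fun p : (∀ i, S i) × S c => Function.update p.1 c p.2) ⁻¹' (Set.pi Set.univ s) =
      (Set.pi Set.univ (Function.update s c Set.univ)) ×ˢ (s c) := by
    ext p
    simp only [Set.mem_preimage, Set.mem_pi, Set.mem_univ, true_imp_iff, Set.mem_prod]
    constructor
    · intro h
      refine ⟨fun i => ?_, by simpa using h c⟩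
      rcases eq_or_ne i c with rfl | hi
      · simp
      · simpa [hi] using h i
    · rintro ⟨h1, h2⟩ i
      rcases eq_or_ne i c with rfl | hi
      · simpa using h2
      · simpa [hi] using h1 i
  rw [this, Measure.prod_prod, Measure.pi_pi, ← mul_prod_erase univ _ (mem_univ c),
    ← mul_prod_erase univ (fun i => ν i (s i)) (mem_univ c), Function.update_self, measure_univ,
    one_mul, mul_comm]
  congr 1
  refine prod_congr rfl fun i hi => ?_
  rw [Function.update_of_ne (ne_of_mem_erase hi)]

theorem integrable_pi (F : boundedMeasurable S) : Integrable F.1 (Measure.pi ν) := by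
  obtain ⟨hF, C, hC⟩ := F.2
  exact Integrable.of_bound hF.aestronglyMeasurable C (Filter.Eventually.of_forall hC)

theorem integral_avg (c : Fin n) (F : boundedMeasurable S) :
    ∫ x, (avg ν c F).1 x ∂Measure.pi ν = ∫ x, F.1 x ∂Measure.pi ν := by
  have hm : Measurable fun p : (∀ i, S i) × S c => Function.update p.1 c p.2 := measurable_update'
  have hF := integrable_pi ν F
  rw [← map_update_prod_pi ν c] at hF
  conv_rhs => rw [← map_update_prod_pi ν c]
  rw [integral_map hm.aemeasurable hF.aestronglyMeasurable,
    integral_prod (fun p => F.1 (Function.update p.1 c p.2)) (hF.comp_measurable hm)]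
  rfl

theorem integral_avgAll (l : List (Fin n)) (F : boundedMeasurable S) :
    ∫ x, (avgAll ν l F).1 x ∂Measure.pi ν = ∫ x, F.1 x ∂Measure.pi ν := by
  induction l with
  | nil => rfl
  | cons c l ih => rw [avgAll_cons, integral_avg, ih]

theorem avgAll_finRange_apply (F : boundedMeasurable S) (x : ∀ i, S i) :
    (avgAll ν (List.finRange n) F).1 x = ∫ y, F.1 y ∂Measure.pi ν := by
  have h : ∀ y, (avgAll ν (List.finRange n) F).1 y = (avgAll ν (List.finRange n) F).1 x :=
    fun y => apply_eq_of_update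
      (fun j => avgAll_update ν F (List.mem_finRange j)) x y
  rw [← integral_avgAll ν (List.finRange n) F]
  simp [h]

end FullAverage

/-! ### Cumulants of a function of independent random variables -/

section RandomVector

open PowerSeries Finset

theorem coeff_one_log_momentSeries (M : ℕ → ℝ) :
    coeff 1 ((log ℝ).subst (momentSeries M) : ℝ⟦X⟧) = M 1 := by
  rw [coeff_subst_eq_sum _ _ (constantCoeff_momentSeries M)]
  simp [sum_range_succ, momentSeries]

theorem cumulant_one {Ω : Type*} [MeasurableSpace Ω] (μ : Measure Ω) (Z : Ω → ℝ) : cumulant μ 1 Z = ∫ ω, Z ω ∂μ := by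
  have h := coeff_log_momentSeries μ Z one_pos
  rw [coeff_one_log_momentSeries] at h
  simpa using h.symm

variable {Ω : Type*} [MeasurableSpace Ω] {μ : Measure Ω} [IsProbabilityMeasure μ]
  {n m : ℕ} {S : Fin n → Type*} [∀ i, MeasurableSpace (S i)] {X : ∀ i, Ω → S i}

theorem integral_pi_map (hX : ∀ i, Measurable (X i)) (hind : iIndepFun X μ)
    (F : boundedMeasurable S) :
    ∫ y, F.1 y ∂Measure.pi (fun i => μ.map (X i)) = ∫ ω, F.1 (fun i => X i ω) ∂μ := by
  rw [← (iIndepFun_iff_map_fun_eq_pi_map fun i => (hX i).aemeasurable).1 hind,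
    integral_map (measurable_pi_lambda _ hX).aemeasurable F.2.1.aestronglyMeasurable]

/-- After all coordinates have been eliminated, the coefficients are the cumulants divided by
factorials. -/
theorem coeff_eliminateAll_finRange [∀ i, IsProbabilityMeasure (μ.map (X i))]
    (hX : ∀ i, Measurable (X i)) (hind : iIndepFun X μ) (f : boundedMeasurable S) {r : ℕ}
    (hr : 0 < r) (x : ∀ i, S i) :
    (coeff r (eliminateAll (fun i => μ.map (X i)) f (List.finRange n))).1 x =
      cumulant μ r (fun ω => f.1 (fun i => X i ω)) / (r ! : ℝ) := by
  have h1 := (isFormalExp_eliminateAll (fun i => μ.map (X i)) f (List.finRange n)).map (evalAt x)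
  rw [← coeff_log_momentSeries μ _ hr, ← coeff_map_evalAt]
  congr 1
  refine h1.left_unique ?_
  convert isFormalExp_log (constantCoeff_momentSeries _) using 1
  ext k
  rw [coeff_map_evalAt, coeff_mk, map_add, coeff_one, momentSeries, coeff_mk]
  change (k ! : ℝ)⁻¹ * (avgAll (fun i => μ.map (X i)) (List.finRange n) (f ^ k)).1 x = _
  rw [avgAll_finRange_apply, integral_pi_map hX hind]
  change (k ! : ℝ)⁻¹ * ∫ ω, f.1 (fun i => X i ω) ^ k ∂μ = _
  split_ifs with hk
  · simp [hk]
  · rw [zero_add, div_eq_inv_mul]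

theorem abs_cumulant_div_factorial_le
    (hX : ∀ i, Measurable (X i)) (hind : iIndepFun X μ) (f : boundedMeasurable S) {β : ℝ}
    (hβ : 0 < β) (hsum : ∀ v ∈ Icc 1 m, ∀ j : Fin n,
      ∑ V ∈ (powersetCard v univ).filter (fun V : Finset (Fin n) => j ∈ V), mixedDelta V f.1 ≤ β)
    {r : ℕ} (hr : 2 ≤ r) (hrm : r ≤ m) :
    |cumulant μ r (fun ω => f.1 (fun i => X i ω))| / (r ! : ℝ) ≤
      n / 80 * (40 * β / 3) ^ r := by
  have : ∀ i, IsProbabilityMeasure (μ.map (X i)) := fun i =>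
    Measure.isProbabilityMeasure_map (hX i).aemeasurable
  obtain ⟨ω⟩ := nonempty_of_isProbabilityMeasure μ
  set τ : NNReal := ⟨3 / (40 * β), by positivity⟩ with hτ
  have hτc : (τ : ℝ) = 3 / (40 * β) := rfl
  have h := abs_coeff_eliminateAll_le (ν := fun i => μ.map (X i)) (τ := τ)
    (weightedSum_anchoredWeight_base (by rw [hτc]; field_simp; norm_num) hsum)
    (List.finRange n) hr (by omega) (fun i => X i ω)
  rw [coeff_eliminateAll_finRange hX hind f (by omega), List.length_finRange, hτc, abs_div,
    Nat.abs_cast, ← le_div_iff₀ (by positivity)] at h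
  refine h.trans_eq ?_
  rw [div_pow, div_pow]
  field_simp

theorem exists_integral_exp_eq
    (hX : ∀ i, Measurable (X i)) (hind : iIndepFun X μ) (f : boundedMeasurable S) {β : ℝ}
    (hβ : 0 < β) (hsum : ∀ v ∈ Icc 1 m, ∀ j : Fin n,
      ∑ V ∈ (powersetCard v univ).filter (fun V : Finset (Fin n) => j ∈ V), mixedDelta V f.1 ≤ β)
    (hm : 0 < m) (hβ' : β ≤ 3 / 40) :
    ∃ e : ℝ, |e| ≤ n / 80 * (40 * β / 3) ^ (m + 1) ∧
      ∫ ω, Real.exp (f.1 (fun i => X i ω)) ∂μ = Real.exp (∑ r ∈ Icc 1 m,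
        cumulant μ r (fun ω => f.1 (fun i => X i ω)) / (r ! : ℝ) + e) := by
  have : ∀ i, IsProbabilityMeasure (μ.map (X i)) := fun i =>
    Measure.isProbabilityMeasure_map (hX i).aemeasurable
  obtain ⟨ω⟩ := nonempty_of_isProbabilityMeasure μ
  set τ : NNReal := ⟨3 / (40 * β), by positivity⟩ with hτ
  have hτc : (τ : ℝ) = 3 / (40 * β) := rfl
  have hτ1 : 1 ≤ τ := by
    rw [← NNReal.coe_le_coe, hτc, NNReal.coe_one, le_div_iff₀ (by positivity)]
    linarith
  obtain ⟨e, he, hee⟩ := exists_avgAll_expFun (ν := fun i => μ.map (X i)) (f := f) hτ1 hm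
    (weightedSum_anchoredWeight_base (by rw [hτc]; field_simp; norm_num) hsum)
    (List.finRange n) (fun i => X i ω)
  refine ⟨e, ?_, ?_⟩
  · rw [List.length_finRange, hτc, ← le_div_iff₀ (by positivity)] at he
    refine he.trans_eq ?_
    rw [div_pow, div_pow]
    field_simp
  · rw [avgAll_finRange_apply, integral_pi_map hX hind] at hee
    refine hee.trans ?_
    congr 2
    rw [partialSum_apply, sum_range_succ', ← Ico_add_one_right_eq_Icc, sum_Ico_eq_sum_range]
    have h0 := (isFormalExp_eliminateAll (fun i => μ.map (X i)) f
      (List.finRange n)).constantCoeff_left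
    rw [coeff_zero_eq_constantCoeff_apply, h0]
    simp only [Nat.add_sub_cancel]
    refine (add_zero _).trans (sum_congr rfl fun r _ => ?_)
    rw [coeff_eliminateAll_finRange hX hind f (by omega), add_comm 1 r]

end RandomVector

/-! ### The logarithm of the exponential moment -/

section Estimates

open Finset

theorem abs_exp_sub_one_le_exp_abs (x : ℝ) : |Real.exp x - 1| ≤ Real.exp |x| - 1 := by
  rcases le_total 0 x with h | h
  · rw [abs_of_nonneg h, abs_of_nonneg (by linarith [Real.add_one_le_exp x])]
  · rw [abs_of_nonpos h, abs_of_nonpos (by linarith [Real.exp_le_one_iff.2 h])]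
    linarith [Real.add_one_le_exp x, Real.add_one_le_exp (-x)]

theorem abs_sub_le_of_mixedDelta_singleton {n : ℕ} {S : Fin n → Type*} {f : (∀ i, S i) → ℝ}
    (hf : ∃ C : ℝ, ∀ x, |f x| ≤ C) {β : ℝ} (h : ∀ j, mixedDelta {j} f ≤ β) (x y : ∀ i, S i) :
    |f x - f y| ≤ n * β := by
  have hstep : ∀ z j (u : S j), |f z - f (Function.update z j u)| ≤ β := by
    intro z j u
    refine le_trans ?_ (h j)
    obtain ⟨C, hC⟩ := hf
    have := le_ciSup (f := fun p : (∀ i, S i) × (∀ i, S i) => |mixedDiff p.2 {j} f p.1|)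
      ⟨2 ^ ({j} : Finset (Fin n)).card * C, by rintro _ ⟨p, rfl⟩; exact abs_mixedDiff_le hC _ _ _⟩
      (z, Function.update z j u)
    refine le_trans (le_of_eq ?_) this
    simp [mixedDiff_singleton, diffOp_apply]
  have key : ∀ s : Finset (Fin n), |f x - f (s.piecewise y x)| ≤ s.card * β := by
    intro s
    induction s using Finset.induction_on with
    | empty => simp
    | insert j s hj ih =>
      rw [piecewise_insert, card_insert_of_notMem hj]
      have := abs_sub_le (f x) (f (s.piecewise y x)) (f (Function.update (s.piecewise y x) j (y j)))
      push_cast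
      linarith [hstep (s.piecewise y x) j (y j)]
  simpa using key univ

/-- A random variable whose values differ by at most `a` has exponential moment within `e^{±a}` of
the exponential of its mean. -/
theorem abs_log_integral_exp_sub_le {Ω : Type*} [MeasurableSpace Ω] {μ : Measure Ω}
    [IsProbabilityMeasure μ] {Z : Ω → ℝ} (hZ : Measurable Z) {a : ℝ}
    (ha : ∀ ω ω', |Z ω - Z ω'| ≤ a) :
    |Real.log (∫ ω, Real.exp (Z ω) ∂μ) - ∫ ω, Z ω ∂μ| ≤ a := by
  obtain ⟨ω₀⟩ := nonempty_of_isProbabilityMeasure μ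
  have hbd : ∀ ω, |Z ω| ≤ |Z ω₀| + a := fun ω => by
    have := abs_sub_abs_le_abs_sub (Z ω) (Z ω₀)
    linarith [ha ω ω₀]
  have hint : Integrable Z μ := Integrable.of_bound hZ.aestronglyMeasurable _
    (Filter.Eventually.of_forall hbd)
  have hexp : Integrable (fun ω => Real.exp (Z ω)) μ :=
    Integrable.of_bound (Real.measurable_exp.comp hZ).aestronglyMeasurable
      (Real.exp (|Z ω₀| + a)) (Filter.Eventually.of_forall fun ω => by
        rw [Real.norm_eq_abs, Real.abs_exp]
        exact Real.exp_le_exp.2 ((le_abs_self _).trans (hbd ω)))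
  set M := ∫ ω, Z ω ∂μ with hM
  have hdev : ∀ ω, |Z ω - M| ≤ a := by
    intro ω
    have h1 := norm_integral_le_of_norm_le_const (μ := μ) (f := fun ω' => Z ω - Z ω') (C := a)
      (Filter.Eventually.of_forall fun ω' => ha ω ω')
    rw [integral_sub (integrable_const _) hint] at h1
    simpa using h1
  have hlow : Real.exp (M - a) ≤ ∫ ω, Real.exp (Z ω) ∂μ := by
    have := integral_mono (integrable_const (Real.exp (M - a))) hexp (μ := μ) fun ω =>
      Real.exp_le_exp.2 (by linarith [(abs_le.1 (hdev ω)).1])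
    simpa using this
  have hup : ∫ ω, Real.exp (Z ω) ∂μ ≤ Real.exp (M + a) := by
    have := integral_mono hexp (integrable_const (Real.exp (M + a))) (μ := μ) fun ω =>
      Real.exp_le_exp.2 (by linarith [(abs_le.1 (hdev ω)).2])
    simpa using this
  have hpos := (Real.exp_pos _).trans_le hlow
  rw [← Real.le_log_iff_exp_le hpos] at hlow
  rw [← Real.log_le_iff_le_exp hpos] at hup
  rw [abs_le]
  constructor <;> linarith

variable {Ω : Type*} [MeasurableSpace Ω] {μ : Measure Ω} [IsProbabilityMeasure μ]
  {n m : ℕ} {S : Fin n → Type*} [∀ i, MeasurableSpace (S i)] {X : ∀ i, Ω → S i}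

theorem abs_cumulant_le
    (hX : ∀ i, Measurable (X i)) (hind : iIndepFun X μ) (f : boundedMeasurable S) {β : ℝ}
    (hβ : 0 < β) (hsum : ∀ v ∈ Icc 1 m, ∀ j : Fin n,
      ∑ V ∈ (powersetCard v univ).filter (fun V : Finset (Fin n) => j ∈ V), mixedDelta V f.1 ≤ β)
    {r : ℕ} (hr : 2 ≤ r) (hrm : r ≤ m) :
    |cumulant μ r (fun ω => f.1 (fun i => X i ω))| ≤
      0.014 * (n : ℝ) * (((r - 1)! : ℝ) / (r : ℝ)) * (80 * β) ^ r := by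
  have h := abs_cumulant_div_factorial_le hX hind f hβ hsum hr hrm
  rw [div_le_iff₀ (by positivity)] at h
  refine h.trans ?_
  obtain ⟨k, rfl⟩ : ∃ k, r = k + 1 := ⟨r - 1, by omega⟩
  have h1 : ((k + 1 : ℕ) : ℝ) ^ 2 ≤ 6 ^ (k + 1) := by
    have h2 : ((k + 1 : ℕ) : ℝ) ≤ 2 ^ (k + 1) := by exact_mod_cast Nat.lt_two_pow_self.le
    calc ((k + 1 : ℕ) : ℝ) ^ 2 ≤ (2 ^ (k + 1)) ^ 2 := pow_le_pow_left₀ (by positivity) h2 2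
      _ = 4 ^ (k + 1) := by rw [← pow_mul, mul_comm, pow_mul]; norm_num
      _ ≤ 6 ^ (k + 1) := pow_le_pow_left₀ (by norm_num) (by norm_num) _
  have h3 : (80 * β) ^ (k + 1) = 6 ^ (k + 1) * (40 * β / 3) ^ (k + 1) := by
    rw [← mul_pow]
    congr 1
    ring
  rw [h3, Nat.add_sub_cancel, Nat.factorial_succ]
  have hk : (0 : ℝ) < ((k + 1 : ℕ) : ℝ) := by positivity
  have hC : 0 ≤ (n : ℝ) * (k ! : ℝ) * (40 * β / 3) ^ (k + 1) := by positivity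
  have h4 : ((k + 1 : ℕ) : ℝ) / 80 ≤ 0.014 * 6 ^ (k + 1) / ((k + 1 : ℕ) : ℝ) := by
    rw [le_div_iff₀ hk]
    have : (0 : ℝ) ≤ 6 ^ (k + 1) := by positivity
    nlinarith
  calc n / 80 * (40 * β / 3) ^ (k + 1) * (((k + 1) * k ! : ℕ) : ℝ)
      = (((k + 1 : ℕ) : ℝ) / 80) * ((n : ℝ) * (k ! : ℝ) * (40 * β / 3) ^ (k + 1)) := by
        push_cast
        ring
    _ ≤ (0.014 * 6 ^ (k + 1) / ((k + 1 : ℕ) : ℝ)) *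
          ((n : ℝ) * (k ! : ℝ) * (40 * β / 3) ^ (k + 1)) := mul_le_mul_of_nonneg_right h4 hC
    _ = _ := by ring

/-- For small `β` this is the cumulant expansion; for large `β` each term is small enough
by itself. -/
theorem abs_log_integral_exp_sub_sum_le
    (hX : ∀ i, Measurable (X i)) (hind : iIndepFun X μ) (f : boundedMeasurable S) {β : ℝ}
    (hβ : 0 < β) (hsum : ∀ v ∈ Icc 1 m, ∀ j : Fin n,
      ∑ V ∈ (powersetCard v univ).filter (fun V : Finset (Fin n) => j ∈ V), mixedDelta V f.1 ≤ β)
    (hm : 0 < m) :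
    |Real.log (∫ ω, Real.exp (f.1 (fun i => X i ω)) ∂μ) -
      ∑ r ∈ Icc 1 m, cumulant μ r (fun ω => f.1 (fun i => X i ω)) / (r ! : ℝ)| ≤
      n * (100 * β) ^ (m + 1) := by
  rcases le_or_gt β (3 / 40) with hβ' | hβ'
  · obtain ⟨e, he, hee⟩ := exists_integral_exp_eq hX hind f hβ hsum hm hβ'
    rw [hee, Real.log_exp, add_sub_cancel_left]
    refine he.trans ?_
    have : (40 * β / 3) ^ (m + 1) ≤ (100 * β) ^ (m + 1) :=
      pow_le_pow_left₀ (by positivity) (by linarith) _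
    have hn : (0 : ℝ) ≤ n := Nat.cast_nonneg n
    have hp : (0 : ℝ) ≤ (40 * β / 3) ^ (m + 1) := by positivity
    exact mul_le_mul (by linarith) this hp hn
  · set κ : ℕ → ℝ := fun r => cumulant μ r (fun ω => f.1 (fun i => X i ω)) / (r ! : ℝ) with hκ
    have hone : ∀ j, mixedDelta {j} f.1 ≤ β := by
      intro j
      refine le_trans (le_of_eq ?_) (hsum 1 (mem_Icc.2 ⟨le_rfl, hm⟩) j)
      rw [sum_eq_single_of_mem {j} (by simp [mem_powersetCard])]
      intro V hV hne
      rw [mem_filter, mem_powersetCard] at hV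
      obtain ⟨a, rfl⟩ := card_eq_one.1 hV.1.2
      rw [mem_singleton] at hV
      exact absurd (by rw [hV.2]) hne
    have hP : (1 : ℝ) ≤ 100 * β := by linarith
    have hn : (0 : ℝ) ≤ n := Nat.cast_nonneg n
    have h1 : |Real.log (∫ ω, Real.exp (f.1 (fun i => X i ω)) ∂μ) - κ 1| ≤
        n / 100 * (100 * β) ^ (m + 1) := by
      have h := abs_log_integral_exp_sub_le (μ := μ) (Z := fun ω => f.1 (fun i => X i ω))
        (f.2.1.comp (measurable_pi_lambda _ hX)) (a := n * β)
        fun ω ω' => abs_sub_le_of_mixedDelta_singleton f.2.2 hone _ _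
      have hk : κ 1 = ∫ ω, f.1 (fun i => X i ω) ∂μ := by
        simp only [hκ]
        rw [cumulant_one]
        simp
      rw [hk]
      refine h.trans ?_
      have : 100 * β ≤ (100 * β) ^ (m + 1) := le_self_pow₀ hP (by omega)
      have := mul_le_mul_of_nonneg_left this hn
      linarith
    have h2 : |∑ r ∈ Icc 2 m, κ r| ≤ n / 40 * (100 * β) ^ (m + 1) := by
      calc |∑ r ∈ Icc 2 m, κ r| ≤ ∑ r ∈ Icc 2 m, |κ r| := abs_sum_le_sum_abs _ _
        _ ≤ ∑ r ∈ Icc 2 m, (n / 80 * (100 * β) ^ (m + 1)) * (1 / 2) ^ r := by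
            refine sum_le_sum fun r hr => ?_
            rw [mem_Icc] at hr
            simp only [hκ, abs_div, Nat.abs_cast]
            refine (abs_cumulant_div_factorial_le hX hind f hβ hsum hr.1 hr.2).trans ?_
            have h3 : (40 * β / 3) ^ r ≤ (100 * β) ^ r * (1 / 2) ^ r := by
              rw [← mul_pow]
              exact pow_le_pow_left₀ (by positivity) (by linarith) _
            have h4 : (100 * β) ^ r ≤ (100 * β) ^ (m + 1) :=
              pow_le_pow_right₀ hP (by omega)
            have h5 := mul_le_mul_of_nonneg_right h4 (by positivity : (0 : ℝ) ≤ (1 / 2) ^ r)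
            rw [mul_assoc]
            exact mul_le_mul_of_nonneg_left (h3.trans h5) (by positivity)
        _ ≤ ∑ r ∈ range (m + 1), (n / 80 * (100 * β) ^ (m + 1)) * (1 / 2) ^ r := by
            refine sum_le_sum_of_subset_of_nonneg (fun r hr => ?_) fun r _ _ => by positivity
            rw [mem_Icc] at hr
            exact mem_range.2 (by omega)
        _ ≤ (n / 80 * (100 * β) ^ (m + 1)) * 2 := by
            rw [← mul_sum]
            exact mul_le_mul_of_nonneg_left (sum_geometric_two_le _) (by positivity)
        _ = _ := by ring
    have h3 : ∑ r ∈ Icc 1 m, κ r = κ 1 + ∑ r ∈ Icc 2 m, κ r := by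
      rw [← insert_Icc_add_one_left_eq_Icc (show 1 ≤ m from hm), sum_insert (by simp)]
      rfl
    rw [h3, ← sub_sub]
    refine (abs_sub _ _).trans ?_
    have hp : 0 ≤ n * (100 * β) ^ (m + 1) := by positivity
    linarith

end Estimates

end CumulantExpansion

end

theorem theorem3p1 {Ω : Type*} [MeasurableSpace Ω] (μ : Measure Ω) [IsProbabilityMeasure μ]
    (n m : ℕ) (hm : 0 < m) (S : Fin n → Type*) [∀ i, MeasurableSpace (S i)]
    (X : ∀ i, Ω → S i) (hX : ∀ i, Measurable (X i)) (hind : iIndepFun X μ)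
    (f : (∀ i, S i) → ℝ) (hf : Measurable f) (hbdd : ∃ C : ℝ, ∀ x, |f x| ≤ C)
    (α : ℝ) (hα : 0 ≤ α)
    (hsum : ∀ v ∈ Finset.Icc 1 m, ∀ j : Fin n,
      ∑ V ∈ (Finset.powersetCard v Finset.univ).filter (fun V : Finset (Fin n) => j ∈ V),
        CumulantExpansion.mixedDelta V f ≤ α) :
    (∃ δ : ℝ, -1 < δ ∧ |δ| ≤ Real.exp ((100 * α) ^ (m + 1)) - 1 ∧
      ∫ ω, Real.exp (f (fun i => X i ω)) ∂μ =
        (1 + δ) ^ n * Real.exp (∑ r ∈ Finset.Icc 1 m,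
          CumulantExpansion.cumulant μ r (fun ω => f (fun i => X i ω)) / (r ! : ℝ))) ∧
    (∀ r ∈ Finset.Icc 2 m,
      |CumulantExpansion.cumulant μ r (fun ω => f (fun i => X i ω))| ≤
        0.014 * (n : ℝ) * (((r - 1)! : ℝ) / (r : ℝ)) * (80 * α) ^ r) := by
  let F : CumulantExpansion.boundedMeasurable S := ⟨f, hf, hbdd⟩
  -- The estimates need a positive bound, so they are applied with every `β > α`, which matters
  -- when `α = 0`, and then `β` tends to `α`.
  have hsum' : ∀ β, α < β → ∀ v ∈ Finset.Icc 1 m, ∀ j : Fin n,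
      ∑ V ∈ (Finset.powersetCard v Finset.univ).filter (fun V : Finset (Fin n) => j ∈ V),
        CumulantExpansion.mixedDelta V F.1 ≤ β := fun β hβ v hv j => (hsum v hv j).trans hβ.le
  have hlim : ∀ {a : ℝ} {b : ℝ → ℝ}, Continuous b → (∀ β, α < β → a ≤ b β) → a ≤ b α := by
    intro a b hb h
    refine ge_of_tendsto (hb.continuousAt.tendsto.mono_left (nhdsWithin_le_nhds (s := Set.Ioi α))) ?_
    filter_upwards [self_mem_nhdsWithin] with β hβ using h β hβ
  refine ⟨?_, fun r hr => ?_⟩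
  · set K := Real.log (∫ ω, Real.exp (f (fun i => X i ω)) ∂μ) -
      ∑ r ∈ Finset.Icc 1 m, CumulantExpansion.cumulant μ r (fun ω => f (fun i => X i ω)) / (r ! : ℝ) with hK
    have hKle : |K| ≤ n * (100 * α) ^ (m + 1) :=
      hlim (b := fun β => n * (100 * β) ^ (m + 1)) (by fun_prop) fun β hβ =>
        CumulantExpansion.abs_log_integral_exp_sub_sum_le hX hind F (hα.trans_lt hβ) (hsum' β hβ) hm
    have hpos : 0 < ∫ ω, Real.exp (f (fun i => X i ω)) ∂μ := by
      refine integral_exp_pos ?_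
      obtain ⟨C, hC⟩ := hbdd
      refine Integrable.of_bound (Real.measurable_exp.comp
        (hf.comp (measurable_pi_lambda _ hX))).aestronglyMeasurable (Real.exp C)
        (Filter.Eventually.of_forall fun ω => ?_)
      rw [Real.norm_eq_abs, Real.abs_exp]
      exact Real.exp_le_exp.2 ((le_abs_self _).trans (hC _))
    have hKn : (n : ℝ) * (K / n) = K := by
      rcases Nat.eq_zero_or_pos n with hn | hn
      · have : K = 0 := by simpa [hn] using hKle
        rw [this, zero_div, mul_zero]
      · exact mul_div_cancel₀ K (by positivity)
    refine ⟨Real.exp (K / n) - 1, by linarith [Real.exp_pos (K / n)], ?_, ?_⟩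
    · refine (CumulantExpansion.abs_exp_sub_one_le_exp_abs _).trans (sub_le_sub_right (Real.exp_le_exp.2 ?_) _)
      rw [abs_div, Nat.abs_cast]
      exact div_le_of_le_mul₀ (Nat.cast_nonneg n) (by positivity) (by linarith)
    · rw [add_sub_cancel, ← Real.exp_nat_mul, hKn, ← Real.exp_add, hK, sub_add_cancel,
        Real.exp_log hpos]
  · rw [Finset.mem_Icc] at hr
    exact hlim (b := fun β => 0.014 * (n : ℝ) * (((r - 1)! : ℝ) / (r : ℝ)) * (80 * β) ^ r)
      (by fun_prop) fun β hβ =>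
        CumulantExpansion.abs_cumulant_le hX hind F (hα.trans_lt hβ) (hsum' β hβ) hr.1 hr.2
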